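/- Let $\theta\in\mathbb R$, $q=e^{2\pi i\theta}$, and let $A_\theta$ be the unital $\mathbb C$-algebra generated by two invertible elements $U,V$ subject to $UV=qVU$. **Definitions.** A bialgebroid $(H,R,\alpha,\beta,\Delta,\varepsilon)$ over a field $k$ consists of $k$-algebras $H,R$, an algebra map $\alpha:R\to H$ and an anti-algebra map $\beta:R\to H$ with commuting images (so that $H$ is an $R$-bimodule by $a\cdot x\cdot b=\alpha(a)\beta(b)x$), a coassociative $R$-bimodule map $\Delta:H\to H\otimes_RH$, written $\Delta(h)=h^{(1)}\otimes h^{(2)}$, with $\Delta(1)=1\otimes1$, $\Delta(h)(\beta(r)\otimes1-1\otimes\alpha(r))=0$ and $\Delta(gh)=\Delta(g)\Delta(h)$, and an $R$-bimodule map $\varepsilon:H\to R$ with $\varepsilon(1)=1$ that is a two-sided counit for $\Delta$. It is a para-Hopf algebroid if it is equipped with an anti-algebra map $T:H\to H$ (the para-antipode) such that $T\beta=\alpha$, $T(h^{(1)})h^{(2)}=\beta\varepsilon T(h)$, $T^2=\mathrm{id}$ and $T(h^{(1)})^{(1)}h^{(2)}\otimes_R T(h^{(1)})^{(2)}=1\otimes_R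 T(h)$ for all $h\in H$. A normal left Haar system is a map $\varphi:H\to R$ of right $R$-modules with $\alpha(\varphi(h^{(1)}))h^{(2)}=\alpha(\varphi(h))1$ for all $h$, $\alpha\varphi=\beta\varphi$ and $\varphi(1)=1$. For a para-Hopf algebroid put $H_\natural^0=R$ and $H_\natural^n=H\otimes_R\cdots\otimes_RH$ ($n$ factors). The cofaces $\delta_0,\dots,\delta_{n+1}:H_\natural^n\to H_\natural^{n+1}$ are $\delta_0=\beta$, $\delta_1=\alpha$ for $n=0$, and for $n\ge1$: $\delta_0x=1\otimes x$, $\delta_i$ applies $\Delta$ to the $i$-th factor ($1\le i\le n$), $\delta_{n+1}x=x\otimes1$. The cyclic operator is $\tau_n(h_1\otimes\cdots\otimes h_n)=\Delta^{n-1}(T(h_1))\cdot(h_2\otimes\cdots\otimes h_n\otimes1)$ for $n\ge1$, and $\tau_0=\mathrm{id}$. The cyclic cohomology $HC^n(H)$ is the cohomology in degree $n$ of the total complex of the cyclic bicomplex $C^{p,m}=H_\natural^m$ ($p,m\ge0$), whose vertical differential is $b=\sum_{i=0}^{m+1}(-1)^i\delta_i$ for even $p$ and $-b'=-\sum_{i=0}^{m}(-1)^i\delta_i$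 for odd $p$, and whose horizontal differential is $1-\lambda$ for even $p$ and $1+\lambda+\cdots+\lambda^m$ for odd $p$, where $\lambda=(-1)^m\tau_m$. **Corollary (noncommutative torus).** The algebra $A_\theta$ is a para-Hopf algebroid over $R=\mathbb C[U,U^{-1}]$ with $\alpha=\beta$ the natural embedding $R\hookrightarrow A_\theta$ and, for all $n,m\in\mathbb Z$, $$\Delta(U^nV^m)=U^nV^m\otimes_R V^m,\qquad \varepsilon(U^nV^m)=U^n,\qquad T(U^nV^m)=q^{nm}U^nV^{-m},$$ and $\varphi(U^nV^m)=\delta_{m,0}U^n$ defines a normal left Haar system for it. The total differential of its cyclic bicomplex squares to zero, and for all $i\ge0$ $$HC^{2i+1}(A_\theta)=0,\qquad HC^{2i}(A_\theta)\cong\mathbb C[U,U^{-1}]$$ as $\mathbb C$-vector spaces, where the second isomorphism is the one that sends $r\in\mathbb C[U,U^{-1}]=H_\natural^0$ to the class of $r$ placed at $(p,m)=(2i,0)$. -/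

import Mathlib

open scoped TensorProduct LaurentPolynomial

noncomputable section

namespace ParaHopf

universe u v

/-- Total algebra `H`, base algebra `R`, source map `src : R → H` (an algebra map) and target map
`tgt : R → H` (an anti-algebra map) whose images commute.  They make `H` an `R`-bimodule by
`a x b = src a * tgt b * x`. -/
structure BialgebroidBase (k : Type u) (H R : Type v)
    [Field k] [Ring H] [Algebra k H] [Ring R] [Algebra k R] where
  src : R →ₐ[k] H
  tgt : Rᵐᵒᵖ →ₐ[k] H
  src_tgt : ∀ (a : R) (b : Rᵐᵒᵖ), src a * tgt b = tgt b * src a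

namespace BialgebroidBase

variable {k : Type u} {H R : Type v}
  [Field k] [Ring H] [Algebra k H] [Ring R] [Algebra k R] (B : BialgebroidBase k H R)

/-- The left `R`-module structure of `H`, `a x = src a * x`. -/
def actH : R →ₐ[k] Module.End k H := (Algebra.lmul k H).comp B.src

section
variable {N : Type v} [AddCommGroup N] [Module k N] (l : R →ₐ[k] Module.End k N)

/-- The relations `h r ⊗ x = h ⊗ r x`, where `h r = tgt r * h` and `R` acts on the left of `N`
through `l`. -/
def rel : Submodule k (H ⊗[k] N) :=
  Submodule.span k {t | ∃ (r : R) (h : H) (x : N),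
    t = (B.tgt (MulOpposite.op r) * h) ⊗ₜ[k] x - h ⊗ₜ[k] (l r x)}

/-- The tensor product `H ⊗_R N` over the (not necessarily commutative) algebra `R`. -/
abbrev Tens : Type v := (H ⊗[k] N) ⧸ B.rel l

/-- The projection `H ⊗_k N → H ⊗_R N`. -/
def tmk : H ⊗[k] N →ₗ[k] B.Tens l := (B.rel l).mkQ

theorem tmk_surjective : Function.Surjective (B.tmk l) := Submodule.mkQ_surjective _

theorem tmk_rel (r : R) (h : H) (x : N) :
    B.tmk l ((B.tgt (MulOpposite.op r) * h) ⊗ₜ[k] x) = B.tmk l (h ⊗ₜ[k] (l r x)) := by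
  refine (Submodule.Quotient.eq _).2 (Submodule.subset_span ⟨r, h, x, rfl⟩)

/-- A `k`-linear map on `H ⊗_k N` that respects the relations descends to `H ⊗_R N`. -/
def desc {P : Type v} [AddCommGroup P] [Module k P] (f : H ⊗[k] N →ₗ[k] P)
    (hf : ∀ (r : R) (h : H) (x : N),
      f ((B.tgt (MulOpposite.op r) * h) ⊗ₜ[k] x) = f (h ⊗ₜ[k] (l r x))) :
    B.Tens l →ₗ[k] P :=
  (B.rel l).liftQ f (by
    refine Submodule.span_le.2 ?_
    rintro _ ⟨r, h, x, rfl⟩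
    simp [hf])

@[simp] theorem desc_mk {P : Type v} [AddCommGroup P] [Module k P] (f : H ⊗[k] N →ₗ[k] P)
    (hf : ∀ (r : R) (h : H) (x : N),
      f ((B.tgt (MulOpposite.op r) * h) ⊗ₜ[k] x) = f (h ⊗ₜ[k] (l r x))) (t : H ⊗[k] N) :
    B.desc l f hf (B.tmk l t) = f t := Submodule.liftQ_apply _ _ _

variable {l} in
theorem tens_ext {P : Type*} [AddCommGroup P] [Module k P] {f g : B.Tens l →ₗ[k] P}
    (h : ∀ (a : H) (x : N), f (B.tmk l (a ⊗ₜ[k] x)) = g (B.tmk l (a ⊗ₜ[k] x))) : f = g := by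
  refine Submodule.linearMap_qext _ (TensorProduct.ext' h)

/-- The left `R`-module structure of `H ⊗_R N`, `a (h ⊗ x) = (src a * h) ⊗ x`. -/
def actTens : R →ₐ[k] Module.End k (B.Tens l) :=
  AlgHom.ofLinearMap
    { toFun := fun r => B.desc l (B.tmk l ∘ₗ (LinearMap.mulLeft k (B.src r)).rTensor N) (by
        intro s h x
        simp only [LinearMap.comp_apply, LinearMap.rTensor_tmul, LinearMap.mulLeft_apply]
        rw [← mul_assoc, B.src_tgt, mul_assoc, B.tmk_rel])
      map_add' := by
        intro r s
        refine B.tens_ext fun a x => ?_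
        simp [add_mul, TensorProduct.add_tmul]
      map_smul' := by
        intro c r
        refine B.tens_ext fun a x => ?_
        simp [← TensorProduct.smul_tmul'] }
    (by
      refine B.tens_ext fun a x => ?_
      simp)
    (by
      intro r s
      refine B.tens_ext fun a x => ?_
      simp)

@[simp] theorem actTens_mk (r : R) (h : H) (x : N) :
    B.actTens l r (B.tmk l (h ⊗ₜ[k] x)) = B.tmk l ((B.src r * h) ⊗ₜ[k] x) := by
  simp [actTens]

end

/-- The `R`-bimodule tensor product `H ⊗_R H`. -/
abbrev HH : Type v := B.Tens B.actH

/-- The projection `H ⊗_k H → H ⊗_R H`. -/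
abbrev mkHH : H ⊗[k] H →ₗ[k] B.HH := B.tmk B.actH

section
variable {N : Type v} [AddCommGroup N] [Module k N] (l : R →ₐ[k] Module.End k N)

/-- The map `(H ⊗_R H) ⊗_k N → H ⊗_R (H ⊗_R N)`, `(a ⊗ b) ⊗ x ↦ a ⊗ (b ⊗ x)`. -/
def assoc : B.HH ⊗[k] N →ₗ[k] B.Tens (B.actTens l) :=
  TensorProduct.lift (B.desc B.actH
    (TensorProduct.curry
      (B.tmk (B.actTens l) ∘ₗ (B.tmk l).lTensor H ∘ₗ (TensorProduct.assoc k H H N).toLinearMap))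
    (by
      intro r a b
      ext x
      simp [B.tmk_rel, actH]))

@[simp] theorem assoc_tmul (a b : H) (x : N) :
    B.assoc l (B.mkHH (a ⊗ₜ[k] b) ⊗ₜ[k] x) =
      B.tmk (B.actTens l) (a ⊗ₜ[k] B.tmk l (b ⊗ₜ[k] x)) := by
  simp [assoc]

end

end BialgebroidBase

/-- A bialgebroid over `k`.  Every operation that is applied to an element `comul h` of `H ⊗_R H`
is computed on a representative `t` of it in `H ⊗_k H`, and the axiom is required for all
representatives; in particular the operation is well defined. -/
structure Bialgebroid (k : Type u) (H R : Type v)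
    [Field k] [Ring H] [Algebra k H] [Ring R] [Algebra k R] extends
    BialgebroidBase k H R where
  /-- the coproduct `H → H ⊗_R H` -/
  comul : H →ₗ[k] toBialgebroidBase.HH
  /-- `comul` is a map of `R`-bimodules -/
  comul_bimodule : ∀ (a b : R) (h : H) (t : H ⊗[k] H), toBialgebroidBase.mkHH t = comul h →
    comul (src a * tgt (MulOpposite.op b) * h) =
      toBialgebroidBase.mkHH ((src a ⊗ₜ[k] tgt (MulOpposite.op b)) * t)
  comul_one : comul 1 = toBialgebroidBase.mkHH (1 ⊗ₜ[k] 1)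
  /-- coassociativity in `H ⊗_R H ⊗_R H` -/
  coassoc : ∀ (h : H) (t : H ⊗[k] H), toBialgebroidBase.mkHH t = comul h →
    toBialgebroidBase.assoc toBialgebroidBase.actH (comul.rTensor H t) =
      toBialgebroidBase.tmk (toBialgebroidBase.actTens toBialgebroidBase.actH)
        (comul.lTensor H t)
  /-- `comul h · (tgt r ⊗ 1 - 1 ⊗ src r) = 0` -/
  comul_annihilates : ∀ (r : R) (h : H) (t : H ⊗[k] H), toBialgebroidBase.mkHH t = comul h →
    toBialgebroidBase.mkHH
      (t * (tgt (MulOpposite.op r) ⊗ₜ[k] (1 : H) - (1 : H) ⊗ₜ[k] src r)) = 0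
  /-- `comul (g h) = comul g · comul h` -/
  comul_mul : ∀ (g h : H) (s t : H ⊗[k] H), toBialgebroidBase.mkHH s = comul g →
    toBialgebroidBase.mkHH t = comul h → comul (g * h) = toBialgebroidBase.mkHH (s * t)
  /-- the counit `H → R` -/
  counit : H →ₗ[k] R
  /-- `counit` is a map of `R`-bimodules -/
  counit_bimodule : ∀ (a b : R) (h : H),
    counit (src a * tgt (MulOpposite.op b) * h) = a * counit h * b
  counit_one : counit 1 = 1
  /-- `(counit ⊗ id) comul = id`, where `r ⊗ h ∈ R ⊗_R H` is identified with `src r * h` -/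
  counit_left : ∀ (h : H) (t : H ⊗[k] H), toBialgebroidBase.mkHH t = comul h →
    LinearMap.mul' k H ((src.toLinearMap ∘ₗ counit).rTensor H t) = h
  /-- `(id ⊗ counit) comul = id`, where `h ⊗ r ∈ H ⊗_R R` is identified with `tgt r * h` -/
  counit_right : ∀ (h : H) (t : H ⊗[k] H), toBialgebroidBase.mkHH t = comul h →
    LinearMap.mul' k H (TensorProduct.comm k H H
      ((tgt.toLinearMap ∘ₗ (MulOpposite.opLinearEquiv k).toLinearMap ∘ₗ counit).lTensor H t)) = h

namespace Bialgebroid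

variable {k : Type u} {H R : Type v}
  [Field k] [Ring H] [Algebra k H] [Ring R] [Algebra k R] (B : Bialgebroid k H R)

section
variable {N : Type v} [AddCommGroup N] [Module k N] (l : R →ₐ[k] Module.End k N)
  (d : H →ₐ[k] Module.End k N) (hd : ∀ r, d (B.src r) = l r)

/-- `(a ⊗_k b, g ⊗_k x) ↦ a g ⊗_R b x`, for a left `H`-module `N`. -/
def act₀ : H ⊗[k] H →ₗ[k] H ⊗[k] N →ₗ[k] B.Tens l :=
  (LinearMap.compRight k (B.tmk l)) ∘ₗ
    TensorProduct.homTensorHomMap (RingHom.id k) H N H N ∘ₗ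
      TensorProduct.map (Algebra.lmul k H).toLinearMap d.toLinearMap

@[simp] theorem act₀_tmul (a b g : H) (x : N) :
    B.act₀ l d (a ⊗ₜ[k] b) (g ⊗ₜ[k] x) = B.tmk l ((a * g) ⊗ₜ[k] d b x) := by
  simp [act₀]

theorem act₀_mk_eq (hd : ∀ r, d (B.src r) = l r) {s t : H ⊗[k] H} (h : B.mkHH s = B.mkHH t) :
    B.act₀ l d s = B.act₀ l d t := by
  have h1 : s - t ∈ B.rel B.actH := (Submodule.Quotient.eq _).1 h
  have h2 : B.rel B.actH ≤ LinearMap.ker (B.act₀ l d) := by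
    refine Submodule.span_le.2 ?_
    rintro _ ⟨r, a, b, rfl⟩
    refine LinearMap.mem_ker.2 (TensorProduct.ext' fun g x => ?_)
    simp [BialgebroidBase.actH, mul_assoc, BialgebroidBase.tmk_rel, hd]
  have h3 := LinearMap.mem_ker.1 (h2 h1)
  rwa [map_sub, sub_eq_zero] at h3

theorem act₀_mul_tmul (t : H ⊗[k] H) (a b g : H) (x : N) :
    B.act₀ l d (t * (a ⊗ₜ[k] b)) (g ⊗ₜ[k] x) = B.act₀ l d t ((a * g) ⊗ₜ[k] d b x) := by
  induction t using TensorProduct.induction_on with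
  | zero => simp
  | tmul a' b' => simp [mul_assoc]
  | add s t hs ht => simp [add_mul, hs, ht]

/-- A representative of `comul h` in `H ⊗_k H`. -/
def rep (h : H) : H ⊗[k] H := (B.tmk_surjective B.actH (B.comul h)).choose

theorem mk_rep (h : H) : B.mkHH (B.rep h) = B.comul h :=
  (B.tmk_surjective B.actH (B.comul h)).choose_spec

/-- `h ▷ (g ⊗ x) = h⁽¹⁾ g ⊗ h⁽²⁾ x` for fixed `h`. -/
def diag₀ (h : H) : B.Tens l →ₗ[k] B.Tens l :=
  B.desc l (B.act₀ l d (B.rep h)) (by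
    intro r g x
    have h0 := B.comul_annihilates r h _ (B.mk_rep h)
    have h1 : B.act₀ l d (B.rep h * ((B.tgt (MulOpposite.op r)) ⊗ₜ[k] (1 : H))) =
        B.act₀ l d (B.rep h * ((1 : H) ⊗ₜ[k] B.src r)) := by
      refine B.act₀_mk_eq l d hd ?_
      rwa [mul_sub, map_sub, sub_eq_zero] at h0
    have h2 := LinearMap.congr_fun h1 (g ⊗ₜ[k] x)
    simpa [act₀_mul_tmul, hd] using h2)

theorem diag₀_mk (h : H) (t : H ⊗[k] H) (ht : B.mkHH t = B.comul h) (y : H ⊗[k] N) :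
    B.diag₀ l d hd h (B.tmk l y) = B.act₀ l d t y := by
  rw [diag₀, BialgebroidBase.desc_mk, B.act₀_mk_eq l d hd (s := B.rep h) (t := t)]
  rw [B.mk_rep, ht]

theorem diag₀_act₀ (h : H) (s t : H ⊗[k] H) (ht : B.mkHH t = B.comul h) (y : H ⊗[k] N) :
    B.diag₀ l d hd h (B.act₀ l d s y) = B.act₀ l d (t * s) y := by
  induction s using TensorProduct.induction_on with
  | zero => simp
  | add s s' hs hs' => simp [mul_add, hs, hs']
  | tmul a b =>
    induction y using TensorProduct.induction_on with
    | zero => simp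
    | add y y' hy hy' => simp only [map_add, hy, hy']
    | tmul g x => rw [act₀_tmul, B.diag₀_mk l d hd h t ht, act₀_mul_tmul]

/-- The diagonal left action of `H` on `H ⊗_R N`, `h ▷ (g ⊗ x) = h⁽¹⁾ g ⊗ h⁽²⁾ x`, for a left
`H`-module `N` (action `d`) whose `R`-module structure `l` is the restriction along `src`. -/
def diag : H →ₐ[k] Module.End k (B.Tens l) :=
  AlgHom.ofLinearMap
    { toFun := fun h => B.diag₀ l d hd h
      map_add' := by
        intro g h
        refine B.tens_ext fun a x => ?_
        rw [LinearMap.add_apply, B.diag₀_mk l d hd g _ (B.mk_rep g),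
          B.diag₀_mk l d hd h _ (B.mk_rep h),
          B.diag₀_mk l d hd (g + h) (B.rep g + B.rep h) (by simp [mk_rep])]
        simp
      map_smul' := by
        intro c h
        refine B.tens_ext fun a x => ?_
        rw [RingHom.id_apply, LinearMap.smul_apply, B.diag₀_mk l d hd h _ (B.mk_rep h),
          B.diag₀_mk l d hd (c • h) (c • B.rep h) (by simp [mk_rep])]
        simp }
    (by
      refine B.tens_ext fun a x => ?_
      refine (B.diag₀_mk l d hd 1 (1 ⊗ₜ[k] 1) B.comul_one.symm _).trans ?_
      simp)
    (by
      intro g h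
      refine B.tens_ext fun a x => ?_
      refine (B.diag₀_mk l d hd (g * h) (B.rep g * B.rep h)
        (B.comul_mul g h _ _ (B.mk_rep g) (B.mk_rep h)).symm _).trans ?_
      refine Eq.trans ?_ (congrArg (B.diag₀ l d hd g)
        (B.diag₀_mk l d hd h _ (B.mk_rep h) _).symm)
      exact (B.diag₀_act₀ l d hd g _ _ (B.mk_rep g) _).symm)

theorem diag_mk (h : H) (t : H ⊗[k] H) (ht : B.mkHH t = B.comul h) (y : H ⊗[k] N) :
    B.diag l d hd h (B.tmk l y) = B.act₀ l d t y := B.diag₀_mk l d hd h t ht y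

theorem diag_src (r : R) : B.diag l d hd (B.src r) = B.actTens l r := by
  refine B.tens_ext fun a x => ?_
  rw [B.diag_mk l d hd (B.src r) (B.src r ⊗ₜ[k] 1)]
  · simp
  · have := B.comul_bimodule r 1 1 (1 ⊗ₜ[k] 1) B.comul_one.symm
    simpa using this.symm

end

/-- A left `H`-module over `k` (action `hact`), with its left `R`-module structure `ract`. -/
structure LeftMod : Type (max u (v + 1)) where
  carrier : Type v
  [addCommGroup : AddCommGroup carrier]
  [module : Module k carrier]
  ract : R →ₐ[k] Module.End k carrier
  hact : H →ₐ[k] Module.End k carrier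
  hact_src : ∀ r, hact (B.src r) = ract r

attribute [instance] LeftMod.addCommGroup LeftMod.module

/-- `H` as a left module over itself. -/
abbrev regular : B.LeftMod where
  carrier := H
  ract := B.actH
  hact := Algebra.lmul k H
  hact_src := fun _ => rfl

/-- `H ⊗_R N` with the diagonal action. -/
abbrev tensor (N : B.LeftMod) : B.LeftMod where
  carrier := B.Tens N.ract
  ract := B.actTens N.ract
  hact := B.diag N.ract N.hact N.hact_src
  hact_src := B.diag_src N.ract N.hact N.hact_src

/-- `pow n` is the `(n+1)`-fold tensor product `H ⊗_R (H ⊗_R ( ⋯ ⊗_R H))`. -/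
def pow : ℕ → B.LeftMod
  | 0 => B.regular
  | n + 1 => B.tensor (pow n)

theorem comul_src_mul (r : R) (h : H) :
    B.comul (B.src r * h) = B.actTens B.actH r (B.comul h) := by
  have h1 := B.comul_bimodule r 1 h _ (B.mk_rep h)
  rw [MulOpposite.op_one, map_one, mul_one] at h1
  rw [h1, ← B.mk_rep h]
  generalize B.rep h = t
  induction t using TensorProduct.induction_on with
  | zero => simp
  | tmul a b => simp
  | add s t hs ht => simp only [mul_add, map_add, hs, ht]

section
variable {M N : Type v} [AddCommGroup M] [Module k M] [AddCommGroup N] [Module k N]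
  (lM : R →ₐ[k] Module.End k M) (lN : R →ₐ[k] Module.End k N)

/-- `id ⊗ f : H ⊗_R M → H ⊗_R N` for a map `f : M → N` of left `R`-modules. -/
def idTens (f : M →ₗ[k] N) (hf : ∀ r x, f (lM r x) = lN r (f x)) : B.Tens lM →ₗ[k] B.Tens lN :=
  B.desc lM (B.tmk lN ∘ₗ f.lTensor H) (by
    intro r h x
    simp [hf, BialgebroidBase.tmk_rel])

@[simp] theorem idTens_mk (f : M →ₗ[k] N) (hf : ∀ r x, f (lM r x) = lN r (f x)) (h : H) (x : M) :
    B.idTens lM lN f hf (B.tmk lM (h ⊗ₜ[k] x)) = B.tmk lN (h ⊗ₜ[k] f x) := by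
  simp [idTens]

theorem idTens_act (f : M →ₗ[k] N) (hf : ∀ r x, f (lM r x) = lN r (f x)) (r : R) (y : B.Tens lM) :
    B.idTens lM lN f hf (B.actTens lM r y) = B.actTens lN r (B.idTens lM lN f hf y) := by
  refine LinearMap.congr_fun (f := B.idTens lM lN f hf ∘ₗ B.actTens lM r)
    (g := B.actTens lN r ∘ₗ B.idTens lM lN f hf) (B.tens_ext fun a x => ?_) y
  simp

theorem assoc_act (r : R) (y : B.HH) (x : N) :
    B.assoc lN (B.actTens B.actH r y ⊗ₜ[k] x) =
      B.actTens (B.actTens lN) r (B.assoc lN (y ⊗ₜ[k] x)) := by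
  obtain ⟨t, rfl⟩ := B.tmk_surjective B.actH y
  induction t using TensorProduct.induction_on with
  | zero => simp
  | tmul a b => simp
  | add s t hs ht => simp only [map_add, TensorProduct.add_tmul, hs, ht]

/-- `comul ⊗ id : H ⊗_R N → H ⊗_R (H ⊗_R N)`. -/
def comulTens : B.Tens lN →ₗ[k] B.Tens (B.actTens lN) :=
  B.desc lN (B.assoc lN ∘ₗ B.comul.rTensor N) (by
    intro r h x
    have h1 := B.comul_bimodule 1 r h _ (B.mk_rep h)
    rw [map_one, one_mul] at h1
    rw [LinearMap.comp_apply, LinearMap.comp_apply, LinearMap.rTensor_tmul,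
      LinearMap.rTensor_tmul, h1, ← B.mk_rep h]
    generalize B.rep h = t
    induction t using TensorProduct.induction_on with
    | zero => simp
    | tmul a b => simp [BialgebroidBase.tmk_rel]
    | add s t hs ht => simp only [mul_add, map_add, TensorProduct.add_tmul, hs, ht])

@[simp] theorem comulTens_mk (h : H) (x : N) :
    B.comulTens lN (B.tmk lN (h ⊗ₜ[k] x)) = B.assoc lN (B.comul h ⊗ₜ[k] x) := by
  simp [comulTens]

theorem comulTens_act (r : R) (y : B.Tens lN) :
    B.comulTens lN (B.actTens lN r y) = B.actTens (B.actTens lN) r (B.comulTens lN y) := by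
  refine LinearMap.congr_fun (f := B.comulTens lN ∘ₗ B.actTens lN r)
    (g := B.actTens (B.actTens lN) r ∘ₗ B.comulTens lN) (B.tens_ext fun a x => ?_) y
  simp [comul_src_mul, assoc_act]

end

/-- `h ↦ h ⊗ 1`. -/
def appendOne : H →ₗ[k] B.HH := B.mkHH ∘ₗ (TensorProduct.mk k H H).flip 1

theorem appendOne_act (r : R) (h : H) :
    B.appendOne (B.actH r h) = B.actTens B.actH r (B.appendOne h) := by
  exact (B.actTens_mk B.actH r h 1).symm

/-- Maps of left `R`-modules. -/
def RHom (M N : B.LeftMod) : Type _ :=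
  {f : M.carrier →ₗ[k] N.carrier // ∀ r x, f (M.ract r x) = N.ract r (f x)}

/-- The cofaces `δ₁, …, δ_{m+1}` on the `m`-fold tensor product, `m = n + 1`: `cofaceSucc n i` is
`δ_{i+1}`, for `i ≤ n + 1`. -/
def cofaceSucc : (n : ℕ) → ℕ → B.RHom (B.pow n) (B.pow (n + 1))
  | 0, 0 => ⟨B.comul, B.comul_src_mul⟩
  | 0, _ + 1 => ⟨B.appendOne, B.appendOne_act⟩
  | n + 1, 0 => ⟨B.comulTens (B.pow n).ract, B.comulTens_act (B.pow n).ract⟩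
  | n + 1, i + 1 =>
    ⟨B.idTens (B.pow n).ract (B.pow (n + 1)).ract (cofaceSucc n i).1 (cofaceSucc n i).2,
      B.idTens_act (B.pow n).ract (B.pow (n + 1)).ract (cofaceSucc n i).1 (cofaceSucc n i).2⟩

/-- The spaces of cochains: `R` in degree `0` and `H ⊗_R ⋯ ⊗_R H` (`n` factors) in degree `n`. -/
def Cochain : ℕ → Type v
  | 0 => R
  | n + 1 => (B.pow n).carrier

instance (n : ℕ) : AddCommGroup (B.Cochain n) :=
  match n with
  | 0 => inferInstanceAs (AddCommGroup R)
  | n + 1 => inferInstanceAs (AddCommGroup (B.pow n).carrier)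

instance (n : ℕ) : Module k (B.Cochain n) :=
  match n with
  | 0 => inferInstanceAs (Module k R)
  | n + 1 => inferInstanceAs (Module k (B.pow n).carrier)

/-- The cofaces `δ_i : Cochain n → Cochain (n + 1)`, `0 ≤ i ≤ n + 1`: `δ₀ = tgt` and `δ₁ = src` for
`n = 0`; for `n ≥ 1`, `δ₀ x = 1 ⊗ x`, `δ_i` applies `comul` to the `i`-th factor, and
`δ_{n+1} x = x ⊗ 1`.  (Larger `i` are not used.) -/
def coface : (n : ℕ) → ℕ → (B.Cochain n →ₗ[k] B.Cochain (n + 1))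
  | 0, 0 => (B.tgt.toLinearMap ∘ₗ (MulOpposite.opLinearEquiv k).toLinearMap : R →ₗ[k] H)
  | 0, _ + 1 => (B.src.toLinearMap : R →ₗ[k] H)
  | n + 1, 0 => (B.tmk (B.pow n).ract ∘ₗ TensorProduct.mk k H (B.pow n).carrier 1 :
      (B.pow n).carrier →ₗ[k] (B.pow (n + 1)).carrier)
  | n + 1, i + 1 => (B.cofaceSucc n i).1

/-- `a ⊗ b ↦ S(a)⁽¹⁾ b ⊗ S(a)⁽²⁾`, that is `a ⊗ b ↦ S(a) ▷ (b ⊗ 1)`. -/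
def twist (S : H →ₗ[k] H) : H ⊗[k] H →ₗ[k] B.HH :=
  TensorProduct.lift (LinearMap.lcomp k B.HH B.appendOne ∘ₗ
    (B.tensor B.regular).hact.toLinearMap ∘ₗ S)

/-- A left Haar system that is normal. -/
structure IsNormalLeftHaar (φ : H →ₗ[k] R) : Prop where
  /-- `φ` is a map of right `R`-modules -/
  right_module : ∀ (h : H) (r : R), φ (B.tgt (MulOpposite.op r) * h) = φ h * r
  /-- `src (φ h⁽¹⁾) h⁽²⁾ = src (φ h) 1` -/
  invariant : ∀ (h : H) (t : H ⊗[k] H), B.mkHH t = B.comul h →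
    LinearMap.mul' k H ((B.src.toLinearMap ∘ₗ φ).rTensor H t) = B.src (φ h)
  src_eq_tgt : ∀ h : H, B.src (φ h) = B.tgt (MulOpposite.op (φ h))
  normal : φ 1 = 1

end Bialgebroid

/-- A para-Hopf algebroid: a bialgebroid with a para-antipode `anti`, an anti-algebra map. -/
structure ParaHopfAlgebroid (k : Type u) (H R : Type v)
    [Field k] [Ring H] [Algebra k H] [Ring R] [Algebra k R] extends Bialgebroid k H R where
  anti : H →ₗ[k] H
  anti_one : anti 1 = 1
  anti_mul : ∀ g h : H, anti (g * h) = anti h * anti g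
  anti_tgt : ∀ r : R, anti (tgt (MulOpposite.op r)) = src r
  /-- `anti (h⁽¹⁾) h⁽²⁾ = tgt (counit (anti h))` -/
  anti_left : ∀ (h : H) (t : H ⊗[k] H), toBialgebroid.mkHH t = comul h →
    LinearMap.mul' k H (anti.rTensor H t) = tgt (MulOpposite.op (counit (anti h)))
  anti_anti : ∀ h : H, anti (anti h) = h
  /-- `anti (h⁽¹⁾)⁽¹⁾ h⁽²⁾ ⊗ anti (h⁽¹⁾)⁽²⁾ = 1 ⊗ anti h` -/
  anti_comul : ∀ (h : H) (t : H ⊗[k] H), toBialgebroid.mkHH t = comul h →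
    toBialgebroid.twist anti t = toBialgebroid.mkHH (1 ⊗ₜ[k] anti h)

namespace ParaHopfAlgebroid

variable {k : Type u} {H R : Type v}
  [Field k] [Ring H] [Algebra k H] [Ring R] [Algebra k R] (P : ParaHopfAlgebroid k H R)

/-- The cyclic operator, `τ_n (h₁ ⊗ ⋯ ⊗ h_n) = Δ^{n-1} T(h₁) · (h₂ ⊗ ⋯ ⊗ h_n ⊗ 1)`, which is
`T(h₁) ▷ (h₂ ⊗ ⋯ ⊗ h_n ⊗ 1)` (`T = anti`, `Δ = comul`), with `τ₁ = T` and `τ₀ = id`. -/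
def cyc : (n : ℕ) → (P.Cochain n →ₗ[k] P.Cochain n)
  | 0 => LinearMap.id
  | 1 => (P.anti : H →ₗ[k] H)
  | n + 2 => (P.desc (P.pow n).ract
      (TensorProduct.lift (LinearMap.lcomp k (P.pow (n + 1)).carrier (P.cofaceSucc n (n + 1)).1 ∘ₗ
        (P.pow (n + 1)).hact.toLinearMap ∘ₗ P.anti))
      (by
        intro r h x
        simp only [TensorProduct.lift.tmul, LinearMap.comp_apply, AlgHom.toLinearMap_apply,
          LinearMap.lcomp_apply, P.anti_mul, P.anti_tgt, map_mul, (P.cofaceSucc n (n + 1)).2,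
          Module.End.mul_apply, (P.pow (n + 1)).hact_src]) :
      (P.pow (n + 1)).carrier →ₗ[k] (P.pow (n + 1)).carrier)

/-- `λ_n = (-1)^n τ_n`. -/
def lam (n : ℕ) : Module.End k (P.Cochain n) := (-1 : k) ^ n • P.cyc n

/-- `b = δ₀ - δ₁ + ⋯ + (-1)^{n+1} δ_{n+1}`. -/
def hoch (n : ℕ) : P.Cochain n →ₗ[k] P.Cochain (n + 1) :=
  ∑ i ∈ Finset.range (n + 2), (-1 : k) ^ i • P.coface n i

/-- `b' = δ₀ - δ₁ + ⋯ + (-1)^n δ_n`. -/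
def hoch' (n : ℕ) : P.Cochain n →ₗ[k] P.Cochain (n + 1) :=
  ∑ i ∈ Finset.range (n + 1), (-1 : k) ^ i • P.coface n i

/-- `N = 1 + λ_n + ⋯ + λ_n^n`. -/
def norm (n : ℕ) : Module.End k (P.Cochain n) := ∑ i ∈ Finset.range (n + 1), P.lam n ^ i

/-- Vertical differential of the cyclic bicomplex in column `p`: `b` if `p` is even, `-b'` if `p` is
odd. -/
def vert (p q : ℕ) : P.Cochain q →ₗ[k] P.Cochain (q + 1) :=
  if Even p then P.hoch q else - P.hoch' q

/-- Horizontal differential of the cyclic bicomplex from column `p` to column `p + 1`: `1 - λ` if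
`p` is even, `N` if `p` is odd. -/
def horiz (p q : ℕ) : P.Cochain q →ₗ[k] P.Cochain q :=
  if Even p then 1 - P.lam q else P.norm q

/-- Degree `n` of the total complex of the cyclic bicomplex, which has `Cochain q` at every place
`(p, q)`, `p, q ≥ 0`.  The entry with index `q` is the one at `(n - q, q)`. -/
abbrev Tot (n : ℕ) : Type v := (q : Fin (n + 1)) → P.Cochain q

/-- The vertical contribution to the entry `q` of the total differential. -/
def totVert (n : ℕ) : (q : Fin (n + 2)) → (P.Tot n →ₗ[k] P.Cochain q) :=
  Fin.cases 0 fun q => P.vert (n - q) q ∘ₗ LinearMap.proj q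

/-- The horizontal contribution to the entry `q` of the total differential. -/
def totHoriz (n : ℕ) (q : Fin (n + 2)) : P.Tot n →ₗ[k] P.Cochain q :=
  if h : (q : ℕ) < n + 1 then
    P.horiz (n - q) q ∘ₗ (LinearMap.proj (⟨q, h⟩ : Fin (n + 1)) : P.Tot n →ₗ[k] P.Cochain q)
  else 0

/-- The differential of the total complex. -/
def totD (n : ℕ) : P.Tot n →ₗ[k] P.Tot (n + 1) :=
  LinearMap.pi fun q => P.totVert n q + P.totHoriz n q

/-- The coboundaries in the total complex. -/
def coboundaries : (n : ℕ) → Submodule k (P.Tot n)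
  | 0 => ⊥
  | n + 1 => LinearMap.range (P.totD n)

/-- The cocycles in the total complex. -/
def cocycles (n : ℕ) : Submodule k (P.Tot n) := LinearMap.ker (P.totD n)

/-- The cyclic cohomology `HC^n`: the cohomology of the total complex of the cyclic bicomplex. -/
abbrev HC (n : ℕ) : Type v := P.cocycles n ⧸ (P.coboundaries n).comap (P.cocycles n).subtype

/-- The inclusion of `R = Cochain 0` at the place `(n, 0)` of the cyclic bicomplex. -/
def edge (n : ℕ) : R →ₗ[k] P.Tot n :=
  LinearMap.single k (fun q : Fin (n + 1) => P.Cochain q) ⟨0, Nat.succ_pos n⟩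

end ParaHopfAlgebroid

/-- `q = exp (2 π i θ)`. -/
def torusQ (θ : ℝ) : ℂ := Complex.exp (2 * Real.pi * Complex.I * θ)

/-- The generators `U, U⁻¹, V, V⁻¹`. -/
inductive TorusGen : Type
  | U | Uinv | V | Vinv

/-- The relations `U U⁻¹ = U⁻¹ U = V V⁻¹ = V⁻¹ V = 1` and `U V = q V U`. -/
inductive TorusRel (θ : ℝ) : FreeAlgebra ℂ TorusGen → FreeAlgebra ℂ TorusGen → Prop
  | U_Uinv : TorusRel θ (FreeAlgebra.ι ℂ .U * FreeAlgebra.ι ℂ .Uinv) 1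
  | Uinv_U : TorusRel θ (FreeAlgebra.ι ℂ .Uinv * FreeAlgebra.ι ℂ .U) 1
  | V_Vinv : TorusRel θ (FreeAlgebra.ι ℂ .V * FreeAlgebra.ι ℂ .Vinv) 1
  | Vinv_V : TorusRel θ (FreeAlgebra.ι ℂ .Vinv * FreeAlgebra.ι ℂ .V) 1
  | U_V : TorusRel θ (FreeAlgebra.ι ℂ .U * FreeAlgebra.ι ℂ .V)
      (torusQ θ • (FreeAlgebra.ι ℂ .V * FreeAlgebra.ι ℂ .U))

/-- The algebraic noncommutative torus `A_θ`: the unital `ℂ`-algebra generated by two invertible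
elements `U`, `V` subject to `U V = q V U`. -/
abbrev NCTorus (θ : ℝ) : Type := RingQuot (TorusRel θ)

namespace NCTorus

/-- The class of a generator. -/
def gen (θ : ℝ) (g : TorusGen) : NCTorus θ :=
  RingQuot.mkAlgHom ℂ (TorusRel θ) (FreeAlgebra.ι ℂ g)

/-- The unit `U` of `A_θ`. -/
def U (θ : ℝ) : (NCTorus θ)ˣ where
  val := gen θ .U
  inv := gen θ .Uinv
  val_inv := by
    simpa [gen] using RingQuot.mkAlgHom_rel ℂ (TorusRel.U_Uinv (θ := θ))
  inv_val := by
    simpa [gen] using RingQuot.mkAlgHom_rel ℂ (TorusRel.Uinv_U (θ := θ))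

/-- The unit `V` of `A_θ`. -/
def V (θ : ℝ) : (NCTorus θ)ˣ where
  val := gen θ .V
  inv := gen θ .Vinv
  val_inv := by
    simpa [gen] using RingQuot.mkAlgHom_rel ℂ (TorusRel.V_Vinv (θ := θ))
  inv_val := by
    simpa [gen] using RingQuot.mkAlgHom_rel ℂ (TorusRel.Vinv_V (θ := θ))

/-- The element `U^n V^m` of `A_θ`. -/
def mono (θ : ℝ) (n m : ℤ) : NCTorus θ := ((U θ ^ n * V θ ^ m : (NCTorus θ)ˣ) : NCTorus θ)

end NCTorus

end ParaHopf

end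

noncomputable section

namespace ParaHopf

universe u v

/-! The monomials U^n V^m form a basis of A_θ. All structure maps are explicit on them, so the
axioms of the para-Hopf algebroid and of the Haar system become comparisons of powers of q;
`apply_eq_of_mkHH_eq` carries these from monomials to arbitrary representatives in H ⊗ H.

The cohomology then rests on two formal facts. The first is a contraction: s(h ⊗ x) = φ(h) x
satisfies s δ_0 = id and s δ_{i+1} = δ_i s, so s b + b s = id and s b' + b' s = id in positive
degrees (`contract_hoch`, `contract_hoch'`). Every column of the bicomplex is therefore exact above
row 0. In row 0, b = β - α vanishes, whereas b' = β is injective: each even column contributes one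
copy of R and each odd column nothing. A zigzag pushes every cocycle into row 0
(`exists_eq_totD_add_edge`), where it survives exactly in even total degree.

The second fact is that the cochains satisfy the cocyclic identities (`isCocyclic`), which give (1 -
λ) b = b' (1 - λ), b N = N b' and D² = 0. They become transparent in homogeneous coordinates: attach
to a, x_0, …, x_n the cochain q^(a x_0) U^a V^(x_1 - x_0) ⊗ ⋯ ⊗ V^(x_n - x_0). These cochains span,
a coface repeats one coordinate (the last coface appends x_0), and τ rotates the coordinates, the
factor q^(a x_0) absorbing the scalar of the para-antipode. Every identity is then one between maps
of indices. -/

theorem torusQ_ne_zero (θ : ℝ) : torusQ θ ≠ 0 := Complex.exp_ne_zero _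

/-- Conjugation by u sends v to c v, hence v^m to c^m v^m. Read backwards, conjugation by v^m sends
u to c^(-m) u, and the n-th power of this is the claim. -/
theorem zpow_mul_zpow_of_mul_eq {G : Type*} [Group G] {c u v : G} (hcu : Commute c u)
    (hcv : Commute c v) (h : u * v = c * (v * u)) (n m : ℤ) :
    v ^ m * u ^ n = c ^ (-(m * n)) * (u ^ n * v ^ m) := by
  have h1 : SemiconjBy u v (c * v) := by rw [SemiconjBy, h, mul_assoc]
  have h2 := h1.zpow_right m
  rw [hcv.mul_zpow] at h2
  have h3 : SemiconjBy (v ^ m) u (c ^ (-m) * u) := by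
    rw [SemiconjBy, mul_assoc, h2.eq, zpow_neg]
    group
  have h4 := h3.zpow_right n
  rw [(hcu.zpow_left _).mul_zpow, ← zpow_mul, neg_mul] at h4
  rw [h4.eq, mul_assoc]

/-! ### The basis of monomials of the noncommutative torus -/

namespace NCTorus

variable (θ : ℝ)

theorem U_mul_V : (U θ : NCTorus θ) * V θ = torusQ θ • ((V θ : NCTorus θ) * U θ) := by
  simpa [gen, U, V] using RingQuot.mkAlgHom_rel ℂ (TorusRel.U_V (θ := θ))

theorem mono_zero_zero : mono θ 0 0 = 1 := by simp [mono]

theorem V_zpow_mul_U_zpow (n m : ℤ) : ((V θ ^ m * U θ ^ n : (NCTorus θ)ˣ) : NCTorus θ) =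
    torusQ θ ^ (-(m * n)) • mono θ n m := by
  let c : (NCTorus θ)ˣ := Units.map (algebraMap ℂ (NCTorus θ)).toMonoidHom
    (Units.mk0 _ (torusQ_ne_zero θ))
  have hc : ∀ x, Commute c x := fun x => Units.ext (Algebra.commutes _ _)
  have h := zpow_mul_zpow_of_mul_eq (hc (U θ)) (hc (V θ)) (Units.ext (by
    rw [Units.val_mul, U_mul_V, Algebra.smul_def]; rfl)) n m
  rw [h, Units.val_mul, ← mono, Algebra.smul_def]
  congr 1
  rw [← map_zpow, Units.coe_map, Units.val_zpow_eq_zpow_val]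
  rfl

theorem mono_mul (n m n' m' : ℤ) : mono θ n m * mono θ n' m' =
    torusQ θ ^ (-(m * n')) • mono θ (n + n') (m + m') := by
  have h := V_zpow_mul_U_zpow θ n' m
  calc mono θ n m * mono θ n' m'
      = ((U θ ^ n : (NCTorus θ)ˣ) : NCTorus θ) *
          ((V θ ^ m * U θ ^ n' : (NCTorus θ)ˣ) : NCTorus θ) *
            ((V θ ^ m' : (NCTorus θ)ˣ) : NCTorus θ) := by
        simp only [mono, Units.val_mul, mul_assoc]
    _ = _ := by
        rw [h, mul_smul_comm, smul_mul_assoc, mono, mono, ← Units.val_mul, ← Units.val_mul]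
        congr 2
        rw [← mul_assoc, ← zpow_add, mul_assoc, ← zpow_add]

/-- The weighted shift `e (a, b) ↦ w a • e (a + i, b + j)`. -/
def shift (w : ℤ → ℂ) (i j : ℤ) : Module.End ℂ (ℤ × ℤ →₀ ℂ) :=
  Finsupp.lsum ℂ fun p => w p.1 • Finsupp.lsingle (p.1 + i, p.2 + j)

@[simp] theorem shift_single (w : ℤ → ℂ) (i j a b : ℤ) (c : ℂ) :
    shift w i j (Finsupp.single (a, b) c) = Finsupp.single (a + i, b + j) (w a * c) := by
  simp [shift]

/-- The action of the generators in the regular representation. -/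
def regGen : TorusGen → Module.End ℂ (ℤ × ℤ →₀ ℂ)
  | .U => shift (fun _ => 1) 1 0
  | .Uinv => shift (fun _ => 1) (-1) 0
  -- The weight is the cost of moving V past U^a: V U^a = q^(-a) U^a V.
  | .V => shift (fun a => torusQ θ ^ (-a)) 0 1
  | .Vinv => shift (fun a => torusQ θ ^ a) 0 (-1)

/-- The regular representation of `A_θ` in the coordinates with respect to the monomials. -/
def reg : NCTorus θ →ₐ[ℂ] Module.End ℂ (ℤ × ℤ →₀ ℂ) :=
  RingQuot.liftAlgHom ℂ ⟨FreeAlgebra.lift ℂ (regGen θ), by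
    intro x y h
    have hq := torusQ_ne_zero θ
    induction h <;>
    · refine Finsupp.lhom_ext fun ⟨a, b⟩ c => ?_
      simp [regGen, zpow_neg, zpow_add₀ hq, -Finsupp.single_mul]
      try (congr 1; field_simp)⟩

theorem reg_gen (g : TorusGen) : reg θ (gen θ g) = regGen θ g := by
  simp [reg, gen]

theorem reg_U_zpow (n a b : ℤ) (c : ℂ) :
    reg θ ((U θ ^ n : (NCTorus θ)ˣ) : NCTorus θ) (Finsupp.single (a, b) c) =
      Finsupp.single (a + n, b) c := by
  induction n using Int.induction_on with
  | zero => simp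
  | succ n ih =>
    rw [add_comm, zpow_add, zpow_one, Units.val_mul, map_mul, Module.End.mul_apply, ih]
    rw [show ((U θ : (NCTorus θ)ˣ) : NCTorus θ) = gen θ .U from rfl, reg_gen]
    simp [regGen]; congr 2; ring
  | pred n ih =>
    rw [sub_eq_neg_add, zpow_add, zpow_neg_one, Units.val_mul, map_mul, Module.End.mul_apply, ih]
    rw [show (((U θ)⁻¹ : (NCTorus θ)ˣ) : NCTorus θ) = gen θ .Uinv from rfl, reg_gen]
    simp [regGen]; congr 2; ring

/-- On the line with first index 0 the weights of V and V⁻¹ are q^0 = 1. This case suffices, since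
only the orbit of e (0, 0) is used and V acts before U. -/
theorem reg_V_zpow (m b : ℤ) (c : ℂ) :
    reg θ ((V θ ^ m : (NCTorus θ)ˣ) : NCTorus θ) (Finsupp.single (0, b) c) =
      Finsupp.single (0, b + m) c := by
  induction m using Int.induction_on with
  | zero => simp
  | succ n ih =>
    rw [add_comm, zpow_add, zpow_one, Units.val_mul, map_mul, Module.End.mul_apply, ih]
    rw [show ((V θ : (NCTorus θ)ˣ) : NCTorus θ) = gen θ .V from rfl, reg_gen]
    simp [regGen]; congr 2; ring
  | pred n ih =>
    rw [sub_eq_neg_add, zpow_add, zpow_neg_one, Units.val_mul, map_mul, Module.End.mul_apply, ih]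
    rw [show (((V θ)⁻¹ : (NCTorus θ)ˣ) : NCTorus θ) = gen θ .Vinv from rfl, reg_gen]
    simp [regGen]; congr 2; ring

/-- In the regular representation U^n V^m sends e (0, 0) to e (n, m), and these vectors are
independent. -/
theorem linearIndependent_mono :
    LinearIndependent ℂ (fun p : ℤ × ℤ => mono θ p.1 p.2) := by
  let ev : NCTorus θ →ₗ[ℂ] (ℤ × ℤ →₀ ℂ) :=
    LinearMap.applyₗ (Finsupp.single ((0, 0) : ℤ × ℤ) (1 : ℂ)) ∘ₗ (reg θ).toLinearMap
  refine LinearIndependent.of_comp ev ?_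
  have : ev ∘ (fun p : ℤ × ℤ => mono θ p.1 p.2) = fun p => Finsupp.single p (1 : ℂ) := by
    funext ⟨n, m⟩
    simp [ev, mono, reg_U_zpow, reg_V_zpow]
  rw [this]
  exact Finsupp.linearIndependent_single_one ℂ _

theorem gen_mul_mono_mem (g : TorusGen) (n m : ℤ) : gen θ g * mono θ n m ∈
    Submodule.span ℂ (Set.range fun p : ℤ × ℤ => mono θ p.1 p.2) := by
  have key : ∀ a b : ℤ, mono θ a b * mono θ n m ∈
      Submodule.span ℂ (Set.range fun p : ℤ × ℤ => mono θ p.1 p.2) := by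
    intro a b
    rw [mono_mul]
    exact Submodule.smul_mem _ _ (Submodule.subset_span ⟨(a + n, b + m), rfl⟩)
  cases g with
  | U => simpa [mono, U] using key 1 0
  | Uinv => simpa [mono, U] using key (-1) 0
  | V => simpa [mono, V] using key 0 1
  | Vinv => simpa [mono, V] using key 0 (-1)

/-- The span contains 1 and is stable under left multiplication by the generators, hence by the
whole algebra. -/
theorem span_mono : Submodule.span ℂ (Set.range fun p : ℤ × ℤ => mono θ p.1 p.2) = ⊤ := by
  set S := Submodule.span ℂ (Set.range fun p : ℤ × ℤ => mono θ p.1 p.2)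
  have hgen : ∀ g, ∀ x ∈ S, gen θ g * x ∈ S := by
    intro g x hx
    induction hx using Submodule.span_induction with
    | mem x hx => obtain ⟨⟨n, m⟩, rfl⟩ := hx; exact gen_mul_mono_mem θ g n m
    | zero => simp
    | add x y _ _ hx hy => rw [mul_add]; exact add_mem hx hy
    | smul c x _ hx => rw [mul_smul_comm]; exact Submodule.smul_mem _ _ hx
  have hall : ∀ a : FreeAlgebra ℂ TorusGen, ∀ x ∈ S,
      RingQuot.mkAlgHom ℂ (TorusRel θ) a * x ∈ S := by
    intro a
    induction a using FreeAlgebra.induction with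
    | grade0 r =>
      intro x hx
      rw [AlgHom.commutes, ← Algebra.smul_def]
      exact Submodule.smul_mem _ _ hx
    | grade1 g => exact hgen g
    | mul a b ha hb => intro x hx; rw [map_mul, mul_assoc]; exact ha _ (hb _ hx)
    | add a b ha hb => intro x hx; rw [map_add, add_mul]; exact add_mem (ha _ hx) (hb _ hx)
  refine eq_top_iff.2 fun x _ => ?_
  obtain ⟨a, rfl⟩ := RingQuot.mkAlgHom_surjective ℂ (TorusRel θ) x
  have h1 : (1 : NCTorus θ) ∈ S := Submodule.subset_span ⟨(0, 0), mono_zero_zero θ⟩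
  simpa using hall a 1 h1

/-- The basis of monomials `U^n V^m`. -/
def basis : Module.Basis (ℤ × ℤ) ℂ (NCTorus θ) :=
  Module.Basis.mk (linearIndependent_mono θ) (span_mono θ).ge

variable {θ} in
theorem mono_hom_ext {P : Type*} [AddCommMonoid P] [Module ℂ P] {f g : NCTorus θ →ₗ[ℂ] P}
    (h : ∀ n m, f (mono θ n m) = g (mono θ n m)) : f = g :=
  (basis θ).ext fun ⟨n, m⟩ => by simpa [basis] using h n m

variable {θ} in
/-- The linear map with prescribed values on the monomials. -/
def ofMono {P : Type*} [AddCommMonoid P] [Module ℂ P] (f : ℤ → ℤ → P) : NCTorus θ →ₗ[ℂ] P :=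
  (basis θ).constr ℂ fun p => f p.1 p.2

@[simp] theorem ofMono_mono {P : Type*} [AddCommMonoid P] [Module ℂ P] (f : ℤ → ℤ → P)
    (n m : ℤ) : ofMono f (mono θ n m) = f n m := by
  have := (basis θ).constr_basis ℂ (fun p => f p.1 p.2) (n, m)
  simpa [basis, ofMono] using this

end NCTorus

theorem laurent_hom_ext {k P : Type*} [CommSemiring k] [AddCommMonoid P] [Module k P]
    {f g : k[T;T⁻¹] →ₗ[k] P}
    (h : ∀ n, f (LaurentPolynomial.T n) = g (LaurentPolynomial.T n)) : f = g := by
  refine LinearMap.ext fun p => ?_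
  induction p using LaurentPolynomial.induction_on' with
  | add p q hp hq => rw [map_add, map_add, hp, hq]
  | C_mul_T n a => rw [← LaurentPolynomial.smul_eq_C_mul, map_smul, map_smul, h]

theorem BialgebroidBase.mkHH_mul_sub {k : Type*} {H R : Type u} [Field k] [Ring H]
    [Algebra k H] [Ring R] [Algebra k R] (B : BialgebroidBase k H R) (t a b : H ⊗[k] H) :
    B.mkHH (t * (a - b)) = B.mkHH (t * a) - B.mkHH (t * b) := by
  rw [mul_sub, map_sub]

/-! ### Bialgebroid structure, para-antipode and Haar system of the torus -/

namespace NCTorus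

open LaurentPolynomial (T)

variable (θ : ℝ)

/-- The natural embedding of `ℂ[U, U⁻¹]` into `A_θ`. -/
def embed : ℂ[T;T⁻¹] →ₐ[ℂ] NCTorus θ :=
  AddMonoidAlgebra.lift ℂ (NCTorus θ) ℤ ((Units.coeHom (NCTorus θ)).comp (zpowersHom _ (U θ)))

@[simp] theorem embed_T (n : ℤ) : embed θ (T n) = mono θ n 0 := by
  rw [embed, LaurentPolynomial.T, AddMonoidAlgebra.lift_single]
  simp [mono]

/-- Source and target map of `A_θ`. -/
def bialgebroidBase : BialgebroidBase ℂ (NCTorus θ) ℂ[T;T⁻¹] where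
  src := embed θ
  tgt := (embed θ).comp (AlgEquiv.toOpposite ℂ ℂ[T;T⁻¹]).symm.toAlgHom
  src_tgt a b := by
    change embed θ a * embed θ b.unop = embed θ b.unop * embed θ a
    rw [← map_mul, mul_comm, map_mul]

@[simp] theorem base_src : (bialgebroidBase θ).src = embed θ := rfl

@[simp] theorem base_tgt (r : ℂ[T;T⁻¹]) :
    (bialgebroidBase θ).tgt (MulOpposite.op r) = embed θ r := rfl

theorem base_actH (r : ℂ[T;T⁻¹]) (h : NCTorus θ) :
    (bialgebroidBase θ).actH r h = embed θ r * h := rfl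

theorem mono_zero_mul (a n m : ℤ) : mono θ a 0 * mono θ n m = mono θ (a + n) m := by
  simp [mono_mul]

section

variable {N : Type} [AddCommGroup N] [Module ℂ N] (l : ℂ[T;T⁻¹] →ₐ[ℂ] Module.End ℂ N)

theorem tmk_mono_act (n m a : ℤ) (x : N) :
    (bialgebroidBase θ).tmk l (mono θ n m ⊗ₜ[ℂ] l (T a) x) =
      (bialgebroidBase θ).tmk l (mono θ (a + n) m ⊗ₜ[ℂ] x) := by
  rw [← BialgebroidBase.tmk_rel, base_tgt, embed_T, mono_zero_mul]

end

/-- A normal form: every power of U migrates to the first factor, so that equalities in H ⊗_R H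
reduce to equalities of exponents. -/
theorem mkHH_mono (n m n' m' : ℤ) :
    (bialgebroidBase θ).mkHH (mono θ n m ⊗ₜ[ℂ] mono θ n' m') =
      (bialgebroidBase θ).mkHH (mono θ (n' + n) m ⊗ₜ[ℂ] mono θ 0 m') := by
  rw [← tmk_mono_act, base_actH, embed_T, mono_zero_mul, add_zero]

theorem tmk_mkHH_mono (n m n' m' n'' m'' : ℤ) :
    (bialgebroidBase θ).tmk ((bialgebroidBase θ).actTens (bialgebroidBase θ).actH)
        (mono θ n m ⊗ₜ[ℂ] (bialgebroidBase θ).mkHH (mono θ n' m' ⊗ₜ[ℂ] mono θ n'' m'')) =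
      (bialgebroidBase θ).tmk ((bialgebroidBase θ).actTens (bialgebroidBase θ).actH)
        (mono θ (n'' + n' + n) m ⊗ₜ[ℂ]
          (bialgebroidBase θ).mkHH (mono θ 0 m' ⊗ₜ[ℂ] mono θ 0 m'')) := by
  rw [mkHH_mono, ← tmk_mono_act θ _ n m, BialgebroidBase.actTens_mk, base_src, embed_T,
    mono_zero_mul, add_zero]

/-- The coproduct of `A_θ`. -/
def torusComul : NCTorus θ →ₗ[ℂ] (bialgebroidBase θ).HH :=
  ofMono fun n m => (bialgebroidBase θ).mkHH (mono θ n m ⊗ₜ[ℂ] mono θ 0 m)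

@[simp] theorem torusComul_mono (n m : ℤ) : torusComul θ (mono θ n m) =
    (bialgebroidBase θ).mkHH (mono θ n m ⊗ₜ[ℂ] mono θ 0 m) := ofMono_mono θ _ n m

variable {θ}

/-- A linear map on `H ⊗ H` that is compatible with the relations of `H ⊗_R H` takes the expected
value on every representative of a coproduct. -/
theorem apply_eq_of_mkHH_eq {P : Type} [AddCommGroup P] [Module ℂ P]
    {f : NCTorus θ ⊗[ℂ] NCTorus θ →ₗ[ℂ] P} (g : NCTorus θ →ₗ[ℂ] P)
    (hf : ∀ a n m n' m' : ℤ, f (mono θ (a + n) m ⊗ₜ[ℂ] mono θ n' m') =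
      f (mono θ n m ⊗ₜ[ℂ] mono θ (a + n') m'))
    (hg : ∀ n m : ℤ, f (mono θ n m ⊗ₜ[ℂ] mono θ 0 m) = g (mono θ n m))
    {h : NCTorus θ} {t : NCTorus θ ⊗[ℂ] NCTorus θ}
    (ht : (bialgebroidBase θ).mkHH t = torusComul θ h) : f t = g h := by
  -- Linearity in x, h and r in turn reduces compatibility with the relations to monomials, where it
  -- is `hf`.
  have hf' : ∀ (r : ℂ[T;T⁻¹]) (h x : NCTorus θ),
      f (((bialgebroidBase θ).tgt (MulOpposite.op r) * h) ⊗ₜ[ℂ] x) =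
        f (h ⊗ₜ[ℂ] ((bialgebroidBase θ).actH r x)) := by
    intro r h x
    have h1 : (f ∘ₗ TensorProduct.mk ℂ _ _ (embed θ r * h)) =
        f ∘ₗ TensorProduct.mk ℂ _ _ h ∘ₗ (bialgebroidBase θ).actH r := by
      refine mono_hom_ext fun n' m' => ?_
      have h2 : (f ∘ₗ (TensorProduct.mk ℂ _ _).flip (mono θ n' m') ∘ₗ
          LinearMap.mulLeft ℂ (embed θ r)) = f ∘ₗ (TensorProduct.mk ℂ _ _).flip
            ((bialgebroidBase θ).actH r (mono θ n' m')) := by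
        refine mono_hom_ext fun n m => ?_
        have h3 : (f ∘ₗ (TensorProduct.mk ℂ _ _).flip (mono θ n' m') ∘ₗ
            (LinearMap.mulRight ℂ (mono θ n m)) ∘ₗ (embed θ).toLinearMap) =
              f ∘ₗ TensorProduct.mk ℂ _ _ (mono θ n m) ∘ₗ
                (LinearMap.mulRight ℂ (mono θ n' m')) ∘ₗ (embed θ).toLinearMap := by
          refine laurent_hom_ext fun a => ?_
          simpa [mono_zero_mul] using hf a n m n' m'
        exact LinearMap.congr_fun h3 r
      exact LinearMap.congr_fun h2 h
    exact LinearMap.congr_fun h1 x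
  have h1 : (bialgebroidBase θ).desc (bialgebroidBase θ).actH f hf' ∘ₗ torusComul θ = g := by
    refine mono_hom_ext fun n m => ?_
    simp [hg]
  rw [← h1, LinearMap.comp_apply, ← ht, BialgebroidBase.desc_mk]

variable (θ)

theorem torusComul_embed_mul (r : ℂ[T;T⁻¹]) (h : NCTorus θ) :
    torusComul θ (embed θ r * h) =
      (bialgebroidBase θ).actTens (bialgebroidBase θ).actH r (torusComul θ h) := by
  have h1 : torusComul θ ∘ₗ LinearMap.mulLeft ℂ (embed θ r) =
      (bialgebroidBase θ).actTens (bialgebroidBase θ).actH r ∘ₗ torusComul θ := by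
    refine mono_hom_ext fun n m => ?_
    have h2 : torusComul θ ∘ₗ LinearMap.mulRight ℂ (mono θ n m) ∘ₗ (embed θ).toLinearMap =
        LinearMap.applyₗ (torusComul θ (mono θ n m)) ∘ₗ
          ((bialgebroidBase θ).actTens (bialgebroidBase θ).actH).toLinearMap := by
      refine laurent_hom_ext fun a => ?_
      simp [mono_zero_mul]
    exact LinearMap.congr_fun h2 r
  exact LinearMap.congr_fun h1 h

theorem torusComul_bimodule (a b : ℂ[T;T⁻¹]) (h : NCTorus θ) (t : NCTorus θ ⊗[ℂ] NCTorus θ)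
    (ht : (bialgebroidBase θ).mkHH t = torusComul θ h) :
    torusComul θ (embed θ a * embed θ b * h) =
      (bialgebroidBase θ).mkHH ((embed θ a ⊗ₜ[ℂ] embed θ b) * t) := by
  -- As α = β, the factor b on the second leg can cross the tensor sign and join a on the first.
  have h1 : (bialgebroidBase θ).mkHH ((embed θ a ⊗ₜ[ℂ] embed θ b) * t) =
      (bialgebroidBase θ).actTens (bialgebroidBase θ).actH (b * a)
        ((bialgebroidBase θ).mkHH t) := by
    clear ht
    induction t using TensorProduct.induction_on with
    | zero => simp
    | tmul x y =>
      have := (bialgebroidBase θ).tmk_rel (bialgebroidBase θ).actH b (embed θ a * x) y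
      rw [base_tgt, base_actH] at this
      rw [Algebra.TensorProduct.tmul_mul_tmul, ← this, BialgebroidBase.actTens_mk, base_src,
        map_mul, mul_assoc]
    | add s t hs ht => simp only [mul_add, map_add, hs, ht]
  rw [h1, ht, ← torusComul_embed_mul, ← map_mul, mul_comm]

/-- Right multiplication by U^b costs q^(-m b) when U^b passes V^m. Both legs of Δ(U^n V^m) carry
the same V^m, so the two costs agree; for general elements of H ⊗_R H they need not. -/
theorem torusComul_annihilates (r : ℂ[T;T⁻¹]) (h : NCTorus θ) (t : NCTorus θ ⊗[ℂ] NCTorus θ)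
    (ht : (bialgebroidBase θ).mkHH t = torusComul θ h) :
    (bialgebroidBase θ).mkHH
      (t * (embed θ r ⊗ₜ[ℂ] (1 : NCTorus θ) - (1 : NCTorus θ) ⊗ₜ[ℂ] embed θ r)) = 0 := by
  rw [BialgebroidBase.mkHH_mul_sub, sub_eq_zero]
  have h1 : (bialgebroidBase θ).mkHH ∘ₗ LinearMap.mulLeft ℂ t ∘ₗ
      (TensorProduct.mk ℂ _ _).flip 1 ∘ₗ (embed θ).toLinearMap =
        (bialgebroidBase θ).mkHH ∘ₗ LinearMap.mulLeft ℂ t ∘ₗ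
          TensorProduct.mk ℂ _ _ 1 ∘ₗ (embed θ).toLinearMap := by
    refine laurent_hom_ext fun b => ?_
    simp only [LinearMap.comp_apply, LinearMap.flip_apply, TensorProduct.mk_apply,
      AlgHom.toLinearMap_apply, embed_T, LinearMap.mulLeft_apply]
    rw [← sub_eq_zero]
    refine apply_eq_of_mkHH_eq (f := (bialgebroidBase θ).mkHH ∘ₗ LinearMap.mulRight ℂ
      (mono θ b 0 ⊗ₜ[ℂ] (1 : NCTorus θ)) - (bialgebroidBase θ).mkHH ∘ₗ LinearMap.mulRight ℂ
      ((1 : NCTorus θ) ⊗ₜ[ℂ] mono θ b 0)) 0 ?_ ?_ ht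
    · intro a n m n' m'
      simp only [LinearMap.sub_apply, LinearMap.comp_apply, LinearMap.mulRight_apply, mul_one,
        Algebra.TensorProduct.tmul_mul_tmul, mono_mul, TensorProduct.tmul_smul,
        ← TensorProduct.smul_tmul', map_smul]
      rw [mkHH_mono, mkHH_mono θ n, mkHH_mono θ (n + b), mkHH_mono θ (a + n)]
      ring_nf
    · intro n m
      simp only [LinearMap.sub_apply, LinearMap.comp_apply, LinearMap.mulRight_apply, mul_one,
        Algebra.TensorProduct.tmul_mul_tmul, mono_mul, TensorProduct.tmul_smul,
        ← TensorProduct.smul_tmul', map_smul]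
      rw [mkHH_mono θ n]
      simp [add_comm]
  exact LinearMap.congr_fun h1 r

theorem torusComul_mul (g h : NCTorus θ) (s t : NCTorus θ ⊗[ℂ] NCTorus θ)
    (hs : (bialgebroidBase θ).mkHH s = torusComul θ g)
    (ht : (bialgebroidBase θ).mkHH t = torusComul θ h) :
    torusComul θ (g * h) = (bialgebroidBase θ).mkHH (s * t) := by
  let F : NCTorus θ ⊗[ℂ] NCTorus θ →ₗ[ℂ] NCTorus θ ⊗[ℂ] NCTorus θ →ₗ[ℂ] (bialgebroidBase θ).HH :=
    (LinearMap.mul ℂ _).compr₂ (bialgebroidBase θ).mkHH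
  let G : NCTorus θ →ₗ[ℂ] NCTorus θ ⊗[ℂ] NCTorus θ →ₗ[ℂ] (bialgebroidBase θ).HH :=
    ofMono fun n m => F (mono θ n m ⊗ₜ[ℂ] mono θ 0 m)
  have hF : ∀ n m n' m' a b a' b' : ℤ, F (mono θ n m ⊗ₜ[ℂ] mono θ n' m')
      (mono θ a b ⊗ₜ[ℂ] mono θ a' b') = torusQ θ ^ (-(m * a) + -(m' * a')) •
        (bialgebroidBase θ).mkHH (mono θ (n' + a' + (n + a)) (m + b) ⊗ₜ[ℂ] mono θ 0 (m' + b')) := by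
    intro n m n' m' a b a' b'
    simp only [F, LinearMap.compr₂_apply, LinearMap.mul_apply', mono_mul,
        Algebra.TensorProduct.tmul_mul_tmul, TensorProduct.tmul_smul,
        ← TensorProduct.smul_tmul', map_smul, smul_smul]
    rw [mkHH_mono, ← zpow_add₀ (torusQ_ne_zero θ), add_comm (-(m * a))]
  -- The order of the two replacements matters. In its first argument `F` respects the relations of
  -- H ⊗_R H whatever the second argument is. In the second argument this holds only once the first
  -- is a coproduct, whose legs carry equal powers of V.
  have h1 : F s = G g := by
    refine apply_eq_of_mkHH_eq G ?_ (fun n m => ?_) hs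
    swap
    · exact (ofMono_mono θ (fun n m => F (mono θ n m ⊗ₜ[ℂ] mono θ 0 m)) n m).symm
    intro a n m n' m'
    refine TensorProduct.ext (mono_hom_ext fun i j => mono_hom_ext fun i' j' => ?_)
    change F _ (mono θ i j ⊗ₜ[ℂ] mono θ i' j') = F _ (mono θ i j ⊗ₜ[ℂ] mono θ i' j')
    rw [hF, hF]
    ring_nf
  have h2 : G.flip t = torusComul θ ∘ₗ (LinearMap.mul ℂ (NCTorus θ)).flip h := by
    refine apply_eq_of_mkHH_eq ((LinearMap.mul ℂ (NCTorus θ)).flip.compr₂ (torusComul θ)) ?_ ?_ ht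
    · intro a n m n' m'
      refine mono_hom_ext fun i j => ?_
      simp only [LinearMap.flip_apply, G, ofMono_mono, hF]
      ring_nf
    · intro n m
      refine mono_hom_ext fun i j => ?_
      simp only [LinearMap.flip_apply, G, ofMono_mono, hF, LinearMap.compr₂_apply,
        LinearMap.mul_apply', mono_mul, map_smul, torusComul_mono]
      simp
  have h3 := LinearMap.congr_fun h2 g
  rw [LinearMap.flip_apply, ← h1] at h3
  exact h3.symm

theorem torusComul_coassoc (h : NCTorus θ) (t : NCTorus θ ⊗[ℂ] NCTorus θ)
    (ht : (bialgebroidBase θ).mkHH t = torusComul θ h) :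
    (bialgebroidBase θ).assoc (bialgebroidBase θ).actH ((torusComul θ).rTensor _ t) =
      (bialgebroidBase θ).tmk ((bialgebroidBase θ).actTens (bialgebroidBase θ).actH)
        ((torusComul θ).lTensor _ t) := by
  let g : NCTorus θ →ₗ[ℂ] (bialgebroidBase θ).Tens
      ((bialgebroidBase θ).actTens (bialgebroidBase θ).actH) :=
    ofMono fun n m => (bialgebroidBase θ).tmk
      ((bialgebroidBase θ).actTens (bialgebroidBase θ).actH)
        (mono θ n m ⊗ₜ[ℂ] (bialgebroidBase θ).mkHH (mono θ 0 m ⊗ₜ[ℂ] mono θ 0 m))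
  refine (apply_eq_of_mkHH_eq (f := (bialgebroidBase θ).assoc _ ∘ₗ (torusComul θ).rTensor _)
    g ?_ ?_ ht).trans (apply_eq_of_mkHH_eq
      (f := (bialgebroidBase θ).tmk _ ∘ₗ (torusComul θ).lTensor _) g ?_ ?_ ht).symm
  · intro a n m n' m'
    simp only [LinearMap.comp_apply, LinearMap.rTensor_tmul, torusComul_mono,
      BialgebroidBase.assoc_tmul]
    rw [tmk_mkHH_mono, tmk_mkHH_mono θ n]
    ring_nf
  · intro n m
    simp only [LinearMap.comp_apply, LinearMap.rTensor_tmul, torusComul_mono,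
      BialgebroidBase.assoc_tmul, g, ofMono_mono]
  · intro a n m n' m'
    simp only [LinearMap.comp_apply, LinearMap.lTensor_tmul, torusComul_mono]
    rw [tmk_mkHH_mono, tmk_mkHH_mono θ n]
    ring_nf
  · intro n m
    simp only [LinearMap.comp_apply, LinearMap.lTensor_tmul, torusComul_mono, g, ofMono_mono]

/-- The counit of `A_θ`. -/
def torusCounit : NCTorus θ →ₗ[ℂ] ℂ[T;T⁻¹] := ofMono fun n _ => T n

@[simp] theorem torusCounit_mono (n m : ℤ) : torusCounit θ (mono θ n m) = T n :=
  ofMono_mono θ _ n m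

theorem torusCounit_embed_mul (r : ℂ[T;T⁻¹]) (h : NCTorus θ) :
    torusCounit θ (embed θ r * h) = r * torusCounit θ h := by
  have h1 : torusCounit θ ∘ₗ LinearMap.mulLeft ℂ (embed θ r) =
      LinearMap.mulLeft ℂ r ∘ₗ torusCounit θ := by
    refine mono_hom_ext fun n m => ?_
    have h2 : torusCounit θ ∘ₗ LinearMap.mulRight ℂ (mono θ n m) ∘ₗ (embed θ).toLinearMap =
        LinearMap.mulRight ℂ (T n) := by
      refine laurent_hom_ext fun a => ?_
      simp only [LinearMap.comp_apply, LinearMap.mulRight_apply, AlgHom.toLinearMap_apply, embed_T,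
        mono_zero_mul, torusCounit_mono, LaurentPolynomial.T_add]
    simpa using LinearMap.congr_fun h2 r
  exact LinearMap.congr_fun h1 h

theorem torusCounit_one : torusCounit θ 1 = 1 := by
  rw [← mono_zero_zero, torusCounit_mono, LaurentPolynomial.T_zero]

theorem torusCounit_embed (r : ℂ[T;T⁻¹]) : torusCounit θ (embed θ r) = r := by
  simpa [torusCounit_one] using torusCounit_embed_mul θ r 1

theorem torusCounit_left (h : NCTorus θ) (t : NCTorus θ ⊗[ℂ] NCTorus θ)
    (ht : (bialgebroidBase θ).mkHH t = torusComul θ h) :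
    LinearMap.mul' ℂ (NCTorus θ)
      (((embed θ).toLinearMap ∘ₗ torusCounit θ).rTensor (NCTorus θ) t) = h := by
  refine apply_eq_of_mkHH_eq (f := LinearMap.mul' ℂ (NCTorus θ) ∘ₗ
    ((embed θ).toLinearMap ∘ₗ torusCounit θ).rTensor (NCTorus θ)) LinearMap.id ?_ ?_ ht
  · intro a n m n' m'
    simp only [LinearMap.comp_apply, LinearMap.rTensor_tmul, LinearMap.mul'_apply,
      torusCounit_mono, AlgHom.toLinearMap_apply, embed_T, mono_zero_mul]
    ring_nf
  · intro n m
    simp [mono_zero_mul]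

theorem torusCounit_right (h : NCTorus θ) (t : NCTorus θ ⊗[ℂ] NCTorus θ)
    (ht : (bialgebroidBase θ).mkHH t = torusComul θ h) :
    LinearMap.mul' ℂ (NCTorus θ) (TensorProduct.comm ℂ (NCTorus θ) (NCTorus θ)
      (((embed θ).toLinearMap ∘ₗ torusCounit θ).lTensor (NCTorus θ) t)) = h := by
  refine apply_eq_of_mkHH_eq (f := LinearMap.mul' ℂ (NCTorus θ) ∘ₗ
    (TensorProduct.comm ℂ (NCTorus θ) (NCTorus θ)).toLinearMap ∘ₗ
    ((embed θ).toLinearMap ∘ₗ torusCounit θ).lTensor (NCTorus θ)) LinearMap.id ?_ ?_ ht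
  · intro a n m n' m'
    simp only [LinearMap.comp_apply, LinearMap.lTensor_tmul, LinearMap.mul'_apply,
      torusCounit_mono, AlgHom.toLinearMap_apply, embed_T, mono_zero_mul, LinearEquiv.coe_coe,
      TensorProduct.comm_tmul]
    ring_nf
  · intro n m
    simp

/-- The bialgebroid structure of `A_θ`. -/
def bialgebroid : Bialgebroid ℂ (NCTorus θ) ℂ[T;T⁻¹] where
  __ := bialgebroidBase θ
  comul := torusComul θ
  comul_bimodule := torusComul_bimodule θ
  comul_one := by
    rw [← mono_zero_zero]
    exact torusComul_mono θ 0 0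
  coassoc := torusComul_coassoc θ
  comul_annihilates := torusComul_annihilates θ
  comul_mul := torusComul_mul θ
  counit := torusCounit θ
  counit_bimodule a b h := by
    change torusCounit θ (embed θ a * embed θ b * h) = _
    rw [mul_assoc, torusCounit_embed_mul, torusCounit_embed_mul, mul_assoc, mul_comm b]
  counit_one := torusCounit_one θ
  counit_left := torusCounit_left θ
  counit_right := torusCounit_right θ

/-- The para-antipode of `A_θ`. -/
def torusAnti : NCTorus θ →ₗ[ℂ] NCTorus θ :=
  ofMono fun n m => torusQ θ ^ (n * m) • mono θ n (-m)

@[simp] theorem torusAnti_mono (n m : ℤ) :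
    torusAnti θ (mono θ n m) = torusQ θ ^ (n * m) • mono θ n (-m) := ofMono_mono θ _ n m

theorem torusAnti_mul (g h : NCTorus θ) :
    torusAnti θ (g * h) = torusAnti θ h * torusAnti θ g := by
  have h1 : (LinearMap.mul ℂ (NCTorus θ)).compr₂ (torusAnti θ) =
      ((LinearMap.mul ℂ (NCTorus θ)).compl₁₂ (torusAnti θ) (torusAnti θ)).flip := by
    refine mono_hom_ext fun n m => mono_hom_ext fun n' m' => ?_
    simp only [LinearMap.compr₂_apply, LinearMap.mul_apply', LinearMap.flip_apply,
      LinearMap.compl₁₂_apply, LinearMap.smul_apply, mono_mul, map_smul,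
      torusAnti_mono, smul_smul, ← zpow_add₀ (torusQ_ne_zero θ)]
    ring_nf
  exact LinearMap.congr_fun (LinearMap.congr_fun h1 g) h

theorem torusAnti_embed (r : ℂ[T;T⁻¹]) : torusAnti θ (embed θ r) = embed θ r := by
  have h1 : torusAnti θ ∘ₗ (embed θ).toLinearMap = (embed θ).toLinearMap :=
    laurent_hom_ext fun a => by simp
  exact LinearMap.congr_fun h1 r

theorem torusAnti_torusAnti (h : NCTorus θ) : torusAnti θ (torusAnti θ h) = h := by
  have h1 : torusAnti θ ∘ₗ torusAnti θ = LinearMap.id := by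
    refine mono_hom_ext fun n m => ?_
    simp [smul_smul, mul_inv_cancel₀ (zpow_ne_zero _ (torusQ_ne_zero θ))]
  exact LinearMap.congr_fun h1 h

theorem torusAnti_left (h : NCTorus θ) (t : NCTorus θ ⊗[ℂ] NCTorus θ)
    (ht : (bialgebroidBase θ).mkHH t = torusComul θ h) :
    LinearMap.mul' ℂ (NCTorus θ) ((torusAnti θ).rTensor (NCTorus θ) t) =
      embed θ (torusCounit θ (torusAnti θ h)) := by
  refine apply_eq_of_mkHH_eq (f := LinearMap.mul' ℂ (NCTorus θ) ∘ₗ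
    (torusAnti θ).rTensor (NCTorus θ)) ((embed θ).toLinearMap ∘ₗ torusCounit θ ∘ₗ torusAnti θ)
    ?_ ?_ ht
  · intro a n m n' m'
    simp only [LinearMap.comp_apply, LinearMap.rTensor_tmul, LinearMap.mul'_apply,
      torusAnti_mono, smul_mul_assoc, mono_mul, smul_smul, ← zpow_add₀ (torusQ_ne_zero θ)]
    ring_nf
  · intro n m
    simp [mono_mul]

theorem bialgebroid_mkHH_mono (n m n' m' : ℤ) :
    (bialgebroid θ).mkHH (mono θ n m ⊗ₜ[ℂ] mono θ n' m') =
      (bialgebroid θ).mkHH (mono θ (n' + n) m ⊗ₜ[ℂ] mono θ 0 m') := mkHH_mono θ n m n' m'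

/-- The coproduct of U^b V^c is an elementary tensor, so the diagonal action is factorwise; the
scalar comes from V^c passing U^n. -/
theorem tensor_hact_mono (N : (bialgebroid θ).LeftMod) (b c n m : ℤ) (x : N.carrier) :
    ((bialgebroid θ).tensor N).hact (mono θ b c)
        ((bialgebroid θ).tmk N.ract (mono θ n m ⊗ₜ[ℂ] x)) =
      torusQ θ ^ (-(c * n)) • (bialgebroid θ).tmk N.ract
        (mono θ (b + n) (c + m) ⊗ₜ[ℂ] N.hact (mono θ 0 c) x) := by
  refine ((bialgebroid θ).diag_mk N.ract N.hact N.hact_src (mono θ b c)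
    (mono θ b c ⊗ₜ[ℂ] mono θ 0 c) (torusComul_mono θ b c).symm _).trans ?_
  rw [Bialgebroid.act₀_tmul, mono_mul, ← TensorProduct.smul_tmul', map_smul]

theorem twist_mono (n m n' m' : ℤ) :
    (bialgebroid θ).twist (torusAnti θ) (mono θ n m ⊗ₜ[ℂ] mono θ n' m') =
      torusQ θ ^ (n * m + m * n') •
        (bialgebroid θ).mkHH (mono θ (n + n') (-m + m') ⊗ₜ[ℂ] mono θ 0 (-m)) := by
  have h1 := tensor_hact_mono θ (bialgebroid θ).regular n (-m) n' m' (1 : NCTorus θ)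
  have h2 : (bialgebroid θ).twist (torusAnti θ) (mono θ n m ⊗ₜ[ℂ] mono θ n' m') =
      torusQ θ ^ (n * m) • ((bialgebroid θ).tensor (bialgebroid θ).regular).hact (mono θ n (-m))
        ((bialgebroid θ).appendOne (mono θ n' m')) := by
    simp only [Bialgebroid.twist, TensorProduct.lift.tmul, LinearMap.comp_apply,
      LinearMap.lcomp_apply, AlgHom.toLinearMap_apply, torusAnti_mono, map_smul,
      LinearMap.smul_apply]
  rw [h2]
  refine (congrArg _ h1).trans ?_
  rw [smul_smul, ← zpow_add₀ (torusQ_ne_zero θ), neg_mul, neg_neg]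
  exact congrArg (fun x => torusQ θ ^ (n * m + m * n') •
    (bialgebroid θ).mkHH (mono θ (n + n') (-m + m') ⊗ₜ[ℂ] x)) (mul_one (mono θ 0 (-m)))

theorem torusAnti_comul (h : NCTorus θ) (t : NCTorus θ ⊗[ℂ] NCTorus θ)
    (ht : (bialgebroid θ).mkHH t = (bialgebroid θ).comul h) :
    (bialgebroid θ).twist (torusAnti θ) t = (bialgebroid θ).mkHH (1 ⊗ₜ[ℂ] torusAnti θ h) := by
  refine apply_eq_of_mkHH_eq (f := (bialgebroid θ).twist (torusAnti θ))
    ((bialgebroid θ).mkHH ∘ₗ TensorProduct.mk ℂ _ _ 1 ∘ₗ torusAnti θ) ?_ ?_ ht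
  · intro a n m n' m'
    rw [twist_mono, twist_mono]
    ring_nf
  · intro n m
    rw [twist_mono]
    simp only [LinearMap.comp_apply, torusAnti_mono, map_smul, TensorProduct.mk_apply]
    rw [← mono_zero_zero, bialgebroid_mkHH_mono θ 0 0]
    simp

/-- The para-Hopf algebroid structure of `A_θ`. -/
def paraHopf : ParaHopfAlgebroid ℂ (NCTorus θ) ℂ[T;T⁻¹] where
  __ := bialgebroid θ
  anti := torusAnti θ
  anti_one := by rw [← mono_zero_zero]; simp
  anti_mul := torusAnti_mul θ
  anti_tgt := torusAnti_embed θ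
  anti_left := torusAnti_left θ
  anti_anti := torusAnti_torusAnti θ
  anti_comul := torusAnti_comul θ

/-- The normal left Haar system of `A_θ`. -/
def torusHaar : NCTorus θ →ₗ[ℂ] ℂ[T;T⁻¹] := ofMono fun n m => if m = 0 then T n else 0

@[simp] theorem torusHaar_mono (n m : ℤ) :
    torusHaar θ (mono θ n m) = if m = 0 then T n else 0 := ofMono_mono θ _ n m

theorem torusHaar_embed_mul (r : ℂ[T;T⁻¹]) (h : NCTorus θ) :
    torusHaar θ (embed θ r * h) = torusHaar θ h * r := by
  have h1 : torusHaar θ ∘ₗ LinearMap.mulLeft ℂ (embed θ r) =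
      LinearMap.mulRight ℂ r ∘ₗ torusHaar θ := by
    refine mono_hom_ext fun n m => ?_
    have h2 : torusHaar θ ∘ₗ LinearMap.mulRight ℂ (mono θ n m) ∘ₗ (embed θ).toLinearMap =
        LinearMap.mulLeft ℂ (if m = 0 then T n else 0) := by
      refine laurent_hom_ext fun a => ?_
      simp only [LinearMap.comp_apply, LinearMap.mulRight_apply, AlgHom.toLinearMap_apply, embed_T,
        mono_zero_mul, torusHaar_mono, LinearMap.mulLeft_apply, ite_mul, zero_mul,
        ← LaurentPolynomial.T_add, add_comm]
    simpa using LinearMap.congr_fun h2 r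
  exact LinearMap.congr_fun h1 h

theorem torusHaar_invariant (h : NCTorus θ) (t : NCTorus θ ⊗[ℂ] NCTorus θ)
    (ht : (bialgebroidBase θ).mkHH t = torusComul θ h) :
    LinearMap.mul' ℂ (NCTorus θ)
      (((embed θ).toLinearMap ∘ₗ torusHaar θ).rTensor (NCTorus θ) t) =
        embed θ (torusHaar θ h) := by
  refine apply_eq_of_mkHH_eq (f := LinearMap.mul' ℂ (NCTorus θ) ∘ₗ
    ((embed θ).toLinearMap ∘ₗ torusHaar θ).rTensor (NCTorus θ))
    ((embed θ).toLinearMap ∘ₗ torusHaar θ) ?_ ?_ ht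
  · intro a n m n' m'
    simp only [LinearMap.comp_apply, LinearMap.rTensor_tmul, LinearMap.mul'_apply,
      torusHaar_mono, AlgHom.toLinearMap_apply]
    split_ifs
    · simp only [embed_T, mono_zero_mul]
      ring_nf
    · simp
  · intro n m
    by_cases hm : m = 0
    · subst hm
      simp [mono_zero_mul]
    · simp [hm]

theorem isNormalLeftHaar : (paraHopf θ).IsNormalLeftHaar (torusHaar θ) where
  right_module h r := torusHaar_embed_mul θ r h
  invariant := torusHaar_invariant θ
  src_eq_tgt _ := rfl
  normal := by rw [← mono_zero_zero]; simp [LaurentPolynomial.T_zero]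

end NCTorus

/-! ### The contraction defined by a normal Haar system -/

namespace Bialgebroid

variable {k : Type u} {H R : Type v}
  [Field k] [Ring H] [Algebra k H] [Ring R] [Algebra k R] {B : Bialgebroid k H R}
  {φ : H →ₗ[k] R} (hφ : B.IsNormalLeftHaar φ)

namespace IsNormalLeftHaar

/-- Evaluation of the Haar system on the first factor, `h ⊗ x ↦ φ h · x`. -/
def contractTens (hφ : B.IsNormalLeftHaar φ) (N : B.LeftMod) :
    B.Tens N.ract →ₗ[k] N.carrier :=
  B.desc N.ract (TensorProduct.lift (N.ract.toLinearMap ∘ₗ φ)) (by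
    intro r h x
    simp [hφ.right_module])

@[simp] theorem contractTens_mk (N : B.LeftMod) (h : H) (x : N.carrier) :
    hφ.contractTens N (B.tmk N.ract (h ⊗ₜ[k] x)) = N.ract (φ h) x :=
  B.desc_mk N.ract _ _ _

theorem contractTens_idTens (M N : B.LeftMod) (f : B.RHom M N) (y : B.Tens M.ract) :
    hφ.contractTens N (B.idTens M.ract N.ract f.1 f.2 y) = f.1 (hφ.contractTens M y) := by
  refine LinearMap.congr_fun (f := hφ.contractTens N ∘ₗ B.idTens M.ract N.ract f.1 f.2)
    (g := f.1 ∘ₗ hφ.contractTens M) (B.tens_ext fun a x => ?_) y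
  simp [f.2]

/-- Left invariance turns φ(h⁽¹⁾) h⁽²⁾ into α(φ h) = β(φ h), and an element of the image of β can
cross the tensor sign to act on x. -/
theorem contractTens_comulTens (N : B.LeftMod) (y : B.Tens N.ract) :
    hφ.contractTens (B.tensor N) (B.comulTens N.ract y) =
      B.tmk N.ract (1 ⊗ₜ[k] hφ.contractTens N y) := by
  refine LinearMap.congr_fun (f := hφ.contractTens (B.tensor N) ∘ₗ B.comulTens N.ract)
    (g := B.tmk N.ract ∘ₗ TensorProduct.mk k H N.carrier 1 ∘ₗ hφ.contractTens N)
    (B.tens_ext fun a x => ?_) y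
  have h1 : ∀ t : H ⊗[k] H, hφ.contractTens (B.tensor N) (B.assoc N.ract (B.mkHH t ⊗ₜ[k] x)) =
      B.tmk N.ract (LinearMap.mul' k H ((B.src.toLinearMap ∘ₗ φ).rTensor H t) ⊗ₜ[k] x) := by
    intro t
    induction t using TensorProduct.induction_on with
    | zero => simp
    | tmul a b =>
      rw [BialgebroidBase.assoc_tmul]
      refine (hφ.contractTens_mk (B.tensor N) a _).trans ((B.actTens_mk _ _ _ _).trans ?_)
      simp
    | add s t hs ht => simp only [map_add, TensorProduct.add_tmul, hs, ht]
  have h2 := B.tmk_rel N.ract (φ a) 1 x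
  rw [mul_one] at h2
  rw [LinearMap.comp_apply, comulTens_mk, ← B.mk_rep, h1, hφ.invariant a _ (B.mk_rep a),
    hφ.src_eq_tgt, h2]
  simp

theorem contractTens_comul (h : H) :
    hφ.contractTens B.regular (B.comul h) = B.tgt (MulOpposite.op (φ h)) := by
  rw [← hφ.src_eq_tgt, ← hφ.invariant h _ (B.mk_rep h), ← B.mk_rep]
  generalize B.rep h = t
  induction t using TensorProduct.induction_on with
  | zero => simp
  | tmul a b =>
    refine (hφ.contractTens_mk B.regular a b).trans ?_
    simp [BialgebroidBase.actH]
  | add s t hs ht => simp only [map_add, hs, ht]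

/-- The contraction of the cochains that evaluates the Haar system on the first factor. -/
def contract (hφ : B.IsNormalLeftHaar φ) : (n : ℕ) → B.Cochain (n + 1) →ₗ[k] B.Cochain n
  | 0 => φ
  | n + 1 => hφ.contractTens (B.pow n)

theorem contract_coface_zero (n : ℕ) (x : B.Cochain n) :
    hφ.contract n (B.coface n 0 x) = x := by
  cases n with
  | zero =>
    have h1 : ∀ r : R, φ (B.tgt (MulOpposite.op r)) = r := fun r => by
      have h2 := hφ.right_module 1 r
      rwa [mul_one, hφ.normal, one_mul] at h2
    exact h1 x
  | succ n =>
    refine (hφ.contractTens_mk (B.pow n) 1 x).trans ?_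
    rw [hφ.normal, map_one]
    rfl

/-- With `contract_coface_zero` this makes `contract` an extra codegeneracy. The four cases are a
coproduct or an appended 1 on a single factor, then a coproduct on the first factor or a coface on
the remaining ones. -/
theorem contract_coface_succ (n i : ℕ) (x : B.Cochain (n + 1)) :
    hφ.contract (n + 1) (B.coface (n + 1) (i + 1) x) = B.coface n i (hφ.contract n x) := by
  match n, i with
  | 0, 0 => exact hφ.contractTens_comul x
  | 0, i + 1 =>
    refine (hφ.contractTens_mk B.regular x 1).trans ?_
    exact mul_one (B.src (φ x))
  | n + 1, 0 => exact hφ.contractTens_comulTens (B.pow n) x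
  | n + 1, i + 1 =>
    exact hφ.contractTens_idTens (B.pow n) (B.pow (n + 1)) (B.cofaceSucc n i) x

end IsNormalLeftHaar

end Bialgebroid

/-! ### Exactness of the columns -/

namespace ParaHopfAlgebroid

variable {k : Type u} {H R : Type v}
  [Field k] [Ring H] [Algebra k H] [Ring R] [Algebra k R] {P : ParaHopfAlgebroid k H R}
  {φ : H →ₗ[k] R} (hφ : P.IsNormalLeftHaar φ)

/-- The term of δ_0 returns x, and the index shift in the other terms flips every sign. The free
upper bound m serves both b and b'. -/
theorem contract_sum_coface (m n : ℕ) (x : P.Cochain (n + 1)) :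
    hφ.contract (n + 1)
        ((∑ i ∈ Finset.range (m + 1), (-1 : k) ^ i • P.coface (n + 1) i) x) =
      x - (∑ i ∈ Finset.range m, (-1 : k) ^ i • P.coface n i) (hφ.contract n x) := by
  rw [Finset.sum_range_succ']
  simp only [LinearMap.add_apply, LinearMap.sum_apply, LinearMap.smul_apply, map_add, map_sum,
    map_smul, hφ.contract_coface_succ, hφ.contract_coface_zero]
  simp only [pow_succ, pow_zero, one_smul, mul_neg, mul_one, neg_smul, Finset.sum_neg_distrib]
  abel

theorem contract_hoch (n : ℕ) (x : P.Cochain (n + 1)) :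
    hφ.contract (n + 1) (P.hoch (n + 1) x) = x - P.hoch n (hφ.contract n x) :=
  contract_sum_coface hφ (n + 2) n x

theorem contract_hoch' (n : ℕ) (x : P.Cochain (n + 1)) :
    hφ.contract (n + 1) (P.hoch' (n + 1) x) = x - P.hoch' n (hφ.contract n x) :=
  contract_sum_coface hφ (n + 1) n x

theorem exists_vert_eq (hφ : P.IsNormalLeftHaar φ) (p q : ℕ) (x : P.Cochain (q + 1))
    (hx : P.vert p (q + 1) x = 0) : ∃ y, P.vert p q y = x := by
  unfold vert at *
  split_ifs at * with hp
  · refine ⟨hφ.contract q x, ?_⟩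
    have h1 := contract_hoch hφ q x
    rw [hx, map_zero] at h1
    exact (sub_eq_zero.1 h1.symm).symm
  -- The sign compensates that of the vertical differential -b'.
  · refine ⟨- hφ.contract q x, ?_⟩
    have h1 := contract_hoch' hφ q x
    rw [neg_eq_zero.1 hx, map_zero] at h1
    rw [LinearMap.neg_apply, map_neg, neg_neg]
    exact (sub_eq_zero.1 h1.symm).symm

/-- In row 0 the sum b' is δ_0 alone, and the contraction is a left inverse of δ_0. -/
theorem eq_zero_of_vert_zero (hφ : P.IsNormalLeftHaar φ) {p : ℕ} (hp : ¬ Even p)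
    (x : P.Cochain 0) (hx : P.vert p 0 x = 0) : x = 0 := by
  rw [vert, if_neg hp, LinearMap.neg_apply, neg_eq_zero] at hx
  have h1 := hφ.contract_coface_zero 0 x
  rw [← h1]
  have h2 : P.hoch' 0 x = P.coface 0 0 x := by simp [hoch']
  rw [← h2, hx, map_zero]

end ParaHopfAlgebroid

/-! ### From the cocyclic identities to the bicomplex -/

theorem comp_finsetSum {k A B C ι : Type*} [CommSemiring k] [AddCommMonoid A] [Module k A]
    [AddCommMonoid B] [Module k B] [AddCommMonoid C] [Module k C] (s : Finset ι)
    (f : ι → A →ₗ[k] B) (g : B →ₗ[k] C) : g ∘ₗ (∑ i ∈ s, f i) = ∑ i ∈ s, g ∘ₗ f i := by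
  ext x
  simp

theorem finsetSum_comp {k A B C ι : Type*} [CommSemiring k] [AddCommMonoid A] [Module k A]
    [AddCommMonoid B] [Module k B] [AddCommMonoid C] [Module k C] (s : Finset ι)
    (f : A →ₗ[k] B) (g : ι → B →ₗ[k] C) : (∑ i ∈ s, g i) ∘ₗ f = ∑ i ∈ s, g i ∘ₗ f := by
  ext x
  simp

/-- The alternating sums of two families of maps that satisfy the cosimplicial identities
compose to zero. -/
theorem alternating_sum_comp_eq_zero {k A B C : Type*} [CommRing k] [AddCommGroup A] [Module k A]
    [AddCommGroup B] [Module k B] [AddCommGroup C] [Module k C] (f : ℕ → A →ₗ[k] B)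
    (g : ℕ → B →ₗ[k] C) (N : ℕ)
    (h : ∀ i j, i ≤ j → j < N → g (j + 1) ∘ₗ f i = g i ∘ₗ f j) :
    (∑ j ∈ Finset.range (N + 1), (-1 : k) ^ j • g j) ∘ₗ
      (∑ i ∈ Finset.range N, (-1 : k) ^ i • f i) = 0 := by
  induction N with
  | zero => simp
  | succ N ih =>
    have h0 := ih fun i j hij hj => h i j hij (hj.trans N.lt_succ_self)
    -- The identities with top index j = N trade all products containing g (N + 1) for those
    -- containing f N; their total signs are opposite, so the two groups cancel.
    have h1 : g (N + 1) ∘ₗ (∑ i ∈ Finset.range (N + 1), (-1 : k) ^ i • f i) =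
        (∑ i ∈ Finset.range (N + 1), (-1 : k) ^ i • g i) ∘ₗ f N := by
      rw [comp_finsetSum, finsetSum_comp]
      refine Finset.sum_congr rfl fun i hi => ?_
      rw [LinearMap.comp_smul, LinearMap.smul_comp,
        h i N (Nat.le_of_lt_succ (Finset.mem_range.1 hi)) N.lt_succ_self]
    rw [Finset.sum_range_succ (n := N + 1), LinearMap.add_comp, LinearMap.smul_comp, h1,
      Finset.sum_range_succ (fun i => (-1 : k) ^ i • f i), LinearMap.comp_add, h0,
      LinearMap.comp_smul, zero_add, pow_succ]
    module

namespace ParaHopfAlgebroid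

variable {k : Type u} {H R : Type v}
  [Field k] [Ring H] [Algebra k H] [Ring R] [Algebra k R] (P : ParaHopfAlgebroid k H R)

/-- The identities of a cocyclic module between cofaces and cyclic operators. -/
structure IsCocyclic : Prop where
  coface_coface : ∀ n i j, i ≤ j → j ≤ n + 1 →
    P.coface (n + 1) (j + 1) ∘ₗ P.coface n i = P.coface (n + 1) i ∘ₗ P.coface n j
  cyc_coface_zero : ∀ n, P.cyc (n + 1) ∘ₗ P.coface n 0 = P.coface n (n + 1)
  cyc_coface_succ : ∀ n i, i ≤ n →
    P.cyc (n + 1) ∘ₗ P.coface n (i + 1) = P.coface n i ∘ₗ P.cyc n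
  cyc_pow : ∀ n, P.cyc n ^ (n + 1) = 1

variable {P} (hP : P.IsCocyclic)
include hP

theorem hoch_hoch (n : ℕ) : P.hoch (n + 1) ∘ₗ P.hoch n = 0 :=
  alternating_sum_comp_eq_zero _ _ (n + 2) fun i j hij hj =>
    hP.coface_coface n i j hij (Nat.le_of_lt_succ hj)

theorem hoch'_hoch' (n : ℕ) : P.hoch' (n + 1) ∘ₗ P.hoch' n = 0 :=
  alternating_sum_comp_eq_zero _ _ (n + 1) fun i j hij hj =>
    hP.coface_coface n i j hij hj.le

theorem lam_coface_zero (n : ℕ) :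
    P.lam (n + 1) ∘ₗ P.coface n 0 = (-1 : k) ^ (n + 1) • P.coface n (n + 1) := by
  rw [lam, LinearMap.smul_comp, hP.cyc_coface_zero]

theorem lam_coface_succ (n i : ℕ) (hi : i ≤ n) :
    P.lam (n + 1) ∘ₗ ((-1 : k) ^ (i + 1) • P.coface n (i + 1)) =
      ((-1 : k) ^ i • P.coface n i) ∘ₗ P.lam n := by
  rw [lam, lam, LinearMap.smul_comp, LinearMap.comp_smul, hP.cyc_coface_succ n i hi,
    LinearMap.smul_comp, LinearMap.comp_smul]
  module

theorem lam_pow (n : ℕ) : P.lam n ^ (n + 1) = 1 := by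
  rw [lam, smul_pow, hP.cyc_pow, ← pow_mul, (Nat.even_mul_succ_self n).neg_one_pow, one_smul]

/-- λ carries each signed coface of b to the preceding one composed with λ, and carries δ_0 to the
signed last coface, which is precisely the difference of b and b'. -/
theorem one_sub_lam_hoch (n : ℕ) :
    (1 - P.lam (n + 1)) ∘ₗ P.hoch n = P.hoch' n ∘ₗ (1 - P.lam n) := by
  have h1 : P.hoch n = P.hoch' n + (-1 : k) ^ (n + 1) • P.coface n (n + 1) :=
    Finset.sum_range_succ _ _
  have h2 : P.lam (n + 1) ∘ₗ P.hoch n =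
      P.hoch' n ∘ₗ P.lam n + (-1 : k) ^ (n + 1) • P.coface n (n + 1) := by
    rw [hoch, hoch', Finset.sum_range_succ', LinearMap.comp_add, comp_finsetSum,
      finsetSum_comp, pow_zero, one_smul, lam_coface_zero hP]
    congr 1
    exact Finset.sum_congr rfl fun i hi =>
      lam_coface_succ hP n i (Nat.le_of_lt_succ (Finset.mem_range.1 hi))
  rw [LinearMap.sub_comp, h2, h1, LinearMap.comp_sub]
  simp [Module.End.one_eq_id]

theorem lam_mul_norm (n : ℕ) : P.lam n * P.norm n = P.norm n := by
  have h1 := mul_neg_geom_sum (P.lam n) (n + 1)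
  rw [lam_pow hP, sub_self, sub_mul, one_mul, sub_eq_zero] at h1
  exact h1.symm

theorem norm_mul_lam (n : ℕ) : P.norm n * P.lam n = P.norm n := by
  have h1 := geom_sum_mul_neg (P.lam n) (n + 1)
  rw [lam_pow hP, sub_self, mul_sub, mul_one, sub_eq_zero] at h1
  exact h1.symm

theorem lam_pow_coface (n i : ℕ) (hi : i ≤ n + 1) :
    (P.lam (n + 1) ^ i) ∘ₗ ((-1 : k) ^ i • P.coface n i) = P.coface n 0 ∘ₗ (P.lam n ^ i) := by
  induction i with
  | zero => simp [Module.End.one_eq_id]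
  | succ i ih =>
    rw [pow_succ, Module.End.mul_eq_comp, LinearMap.comp_assoc, lam_coface_succ hP n i (by omega),
      ← LinearMap.comp_assoc, ih (by omega), LinearMap.comp_assoc, ← Module.End.mul_eq_comp,
      ← pow_succ]

/-- N absorbs powers of λ, so λ^i may be inserted before the i-th coface, turning it into δ_0 λ^i;
the powers sum to N. The symmetric form N δ_0 N is shared with `hoch_norm`. -/
theorem norm_hoch' (n : ℕ) : P.norm (n + 1) ∘ₗ P.hoch' n =
    P.norm (n + 1) ∘ₗ P.coface n 0 ∘ₗ P.norm n := by
  have h1 : ∀ i, P.norm (n + 1) = P.norm (n + 1) ∘ₗ P.lam (n + 1) ^ i := by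
    intro i
    induction i with
    | zero => simp [Module.End.one_eq_id]
    | succ i ih =>
      rw [pow_succ, Module.End.mul_eq_comp, ← LinearMap.comp_assoc, ← ih]
      exact (norm_mul_lam hP _).symm
  have h2 : P.coface n 0 ∘ₗ P.norm n =
      ∑ i ∈ Finset.range (n + 1), P.coface n 0 ∘ₗ (P.lam n ^ i) := comp_finsetSum _ _ _
  rw [h2, hoch', comp_finsetSum, comp_finsetSum]
  refine Finset.sum_congr rfl fun i hi => ?_
  nth_rewrite 1 [h1 i]
  rw [LinearMap.comp_assoc, lam_pow_coface hP n i (Finset.mem_range.1 hi).le]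

theorem hoch_norm (n : ℕ) : P.hoch n ∘ₗ P.norm n =
    P.norm (n + 1) ∘ₗ P.coface n 0 ∘ₗ P.norm n := by
  have h1 : ∀ i, (P.lam n ^ i) ∘ₗ P.norm n = P.norm n := by
    intro i
    induction i with
    | zero => simp [Module.End.one_eq_id]
    | succ i ih =>
      rw [pow_succ, Module.End.mul_eq_comp, LinearMap.comp_assoc]
      exact (congrArg _ (lam_mul_norm hP _)).trans ih
  -- In degree n + 1 the operator λ satisfies λ^(n + 2) = 1, so the exponent n + 2 - i inverts λ^i.
  have h2 : ∀ i ≤ n + 1, ((-1 : k) ^ i • P.coface n i) ∘ₗ P.norm n =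
      (P.lam (n + 1) ^ (n + 1 - i + 1)) ∘ₗ P.coface n 0 ∘ₗ P.norm n := by
    intro i hi
    have h3 : P.lam (n + 1) ^ (n + 1 - i + 1) * P.lam (n + 1) ^ i = 1 := by
      rw [← pow_add, ← lam_pow hP (n + 1)]
      congr 1
      omega
    nth_rewrite 2 [← h1 i]
    rw [← LinearMap.comp_assoc (P.norm n), ← lam_pow_coface hP n i hi,
      ← LinearMap.comp_assoc, ← LinearMap.comp_assoc, ← Module.End.mul_eq_comp, h3,
      Module.End.one_eq_id, LinearMap.id_comp]
  rw [hoch, finsetSum_comp]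
  rw [Finset.sum_congr rfl fun i hi => h2 i (Nat.le_of_lt_succ (Finset.mem_range.1 hi))]
  have h3 : P.norm (n + 1) = ∑ i ∈ Finset.range (n + 2), P.lam (n + 1) ^ (i + 1) := by
    rw [← lam_mul_norm hP (n + 1), norm, Finset.mul_sum]
    simp only [pow_succ']
  rw [h3, finsetSum_comp]
  exact Finset.sum_range_reflect (fun i => (P.lam (n + 1) ^ (i + 1)) ∘ₗ P.coface n 0 ∘ₗ
    P.norm n) (n + 2)

theorem vert_vert (p q : ℕ) : P.vert p (q + 1) ∘ₗ P.vert p q = 0 := by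
  unfold vert
  split_ifs
  · exact hoch_hoch hP q
  · rw [LinearMap.neg_comp, LinearMap.comp_neg, neg_neg, hoch'_hoch' hP]

theorem horiz_horiz (p q : ℕ) : P.horiz (p + 1) q ∘ₗ P.horiz p q = 0 := by
  have h1 := norm_mul_lam hP q
  have h2 := lam_mul_norm hP q
  rw [horiz, horiz]
  by_cases hp : Even p
  · rw [if_neg (Nat.not_even_iff_odd.2 hp.add_one), if_pos hp, ← Module.End.mul_eq_comp, mul_sub,
      mul_one, h1, sub_self]
  · rw [if_pos (Nat.not_even_iff_odd.1 hp).add_one, if_neg hp, ← Module.End.mul_eq_comp, sub_mul,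
      one_mul, h2, sub_self]

theorem vert_horiz (p q : ℕ) :
    P.vert (p + 1) q ∘ₗ P.horiz p q + P.horiz p (q + 1) ∘ₗ P.vert p q = 0 := by
  rw [horiz, horiz, vert, vert]
  by_cases hp : Even p
  · rw [if_neg (Nat.not_even_iff_odd.2 hp.add_one), if_pos hp, if_pos hp, if_pos hp,
      one_sub_lam_hoch hP, LinearMap.neg_comp, neg_add_cancel]
  · rw [if_pos (Nat.not_even_iff_odd.1 hp).add_one, if_neg hp, if_neg hp, if_neg hp,
      LinearMap.comp_neg, norm_hoch' hP, hoch_norm hP, add_neg_cancel]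

end ParaHopfAlgebroid

/-! ### The total complex and its cohomology -/

namespace ParaHopfAlgebroid

variable {k : Type u} {H R : Type v}
  [Field k] [Ring H] [Algebra k H] [Ring R] [Algebra k R] {P : ParaHopfAlgebroid k H R}

/-- The entry at `(n - q, q)` of an element of degree `n` of the total complex, zero for
`q > n`. -/
def entry {n : ℕ} (w : P.Tot n) (q : ℕ) : P.Cochain q :=
  if h : q < n + 1 then w ⟨q, h⟩ else 0

theorem entry_of_gt {n q : ℕ} (w : P.Tot n) (h : n < q) : entry w q = 0 :=
  dif_neg (by omega)

theorem tot_ext {n : ℕ} {w w' : P.Tot n} (h : ∀ q, entry w q = entry w' q) : w = w' := by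
  funext ⟨q, hq⟩
  simpa [entry, hq] using h q

@[simp] theorem entry_zero {n : ℕ} (q : ℕ) : entry (0 : P.Tot n) q = 0 := by
  unfold entry
  split_ifs <;> rfl

theorem entry_sub {n : ℕ} (w w' : P.Tot n) (q : ℕ) :
    entry (w - w') q = entry w q - entry w' q := by
  unfold entry
  split_ifs
  · rfl
  · rw [sub_zero]

theorem entry_single_self {n q : ℕ} (hq : q < n + 1) (x : P.Cochain q) :
    entry (P := P) (n := n) (Pi.single (⟨q, hq⟩ : Fin (n + 1)) x) q = x := by
  rw [entry, dif_pos hq]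
  exact Pi.single_eq_same (M := fun q : Fin (n + 1) => P.Cochain q) ⟨q, hq⟩ x

theorem entry_single_of_ne {n q q' : ℕ} (hq : q < n + 1) (x : P.Cochain q) (h : q' ≠ q) :
    entry (P := P) (n := n) (Pi.single (⟨q, hq⟩ : Fin (n + 1)) x) q' = 0 := by
  rw [entry]
  split_ifs with h'
  · exact Pi.single_eq_of_ne (M := fun q : Fin (n + 1) => P.Cochain q) (i := ⟨q, hq⟩)
      (i' := ⟨q', h'⟩) (fun e => h (congrArg Fin.val e)) x
  · rfl

theorem entry_edge_zero (n : ℕ) (r : R) : entry (P.edge n r) 0 = r :=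
  entry_single_self (P := P) (Nat.succ_pos n) r

theorem entry_edge_succ (n q : ℕ) (r : R) : entry (P.edge n r) (q + 1) = 0 :=
  entry_single_of_ne (P := P) (Nat.succ_pos n) r q.succ_ne_zero

theorem entry_totD_zero {n : ℕ} (w : P.Tot n) :
    entry (P.totD n w) 0 = P.horiz n 0 (entry w 0) := by
  rw [entry, dif_pos (by omega), entry, dif_pos (by omega)]
  change P.totVert n 0 w + P.totHoriz n 0 w = _
  rw [totHoriz, dif_pos (by simp)]
  change (0 : P.Tot n →ₗ[k] P.Cochain 0) w + _ = _
  exact zero_add _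

/-- Where a truncated difference fails to be the true column, the entry that it accompanies lies
outside the complex and is 0. -/
theorem entry_totD_succ {n : ℕ} (w : P.Tot n) (q : ℕ) :
    entry (P.totD n w) (q + 1) = P.vert (n - q) q (entry w q) +
      P.horiz (n - (q + 1)) (q + 1) (entry w (q + 1)) := by
  by_cases hq : q ≤ n
  · rw [entry, dif_pos (by omega), entry, dif_pos (by omega)]
    change P.vert (n - q) q (w ⟨q, _⟩) + P.totHoriz n ⟨q + 1, _⟩ w = _
    congr 1
    rw [totHoriz, entry]
    by_cases h : q + 1 < n + 1
    · rw [dif_pos h, dif_pos h]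
      rfl
    · rw [dif_neg h, dif_neg h, LinearMap.zero_apply, map_zero]
  · rw [entry_of_gt _ (by omega), entry_of_gt _ (by omega), entry_of_gt _ (by omega), map_zero,
      map_zero, add_zero]

section
variable (hP : P.IsCocyclic)
include hP

theorem horiz_horiz_entry {n : ℕ} (w : P.Tot n) (q : ℕ) :
    P.horiz (n - q) (q + 1) (P.horiz (n - (q + 1)) (q + 1) (entry w (q + 1))) = 0 := by
  by_cases hq : q + 1 ≤ n
  · rw [show n - q = n - (q + 1) + 1 by omega]
    exact LinearMap.congr_fun (horiz_horiz hP _ _) _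
  · rw [entry_of_gt _ (by omega), map_zero, map_zero]

theorem vert_horiz_entry {n : ℕ} (w : P.Tot n) (q : ℕ) :
    P.vert (n + 1 - q) q (P.horiz (n - q) q (entry w q)) +
      P.horiz (n - q) (q + 1) (P.vert (n - q) q (entry w q)) = 0 := by
  by_cases hq : q ≤ n
  · rw [show n + 1 - q = n - q + 1 by omega]
    exact LinearMap.congr_fun (vert_horiz hP _ _) _
  · rw [entry_of_gt _ (by omega), map_zero, map_zero, map_zero, map_zero, add_zero]

theorem totD_totD (n : ℕ) : P.totD (n + 1) ∘ₗ P.totD n = 0 := by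
  refine LinearMap.ext fun w => tot_ext fun q => ?_
  rw [LinearMap.comp_apply, LinearMap.zero_apply, entry_zero]
  match q with
  | 0 =>
    rw [entry_totD_zero, entry_totD_zero]
    exact LinearMap.congr_fun (horiz_horiz hP _ _) _
  | 1 =>
    have h1 := vert_horiz_entry hP w 0
    have h2 := horiz_horiz_entry hP w 0
    rw [entry_totD_succ, entry_totD_zero, entry_totD_succ, map_add, Nat.add_sub_add_right, h2,
      add_zero]
    exact h1
  | q + 2 =>
    have h1 := vert_horiz_entry hP w (q + 1)
    have h2 := horiz_horiz_entry hP w (q + 1)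
    have h3 := LinearMap.congr_fun (vert_vert hP (n - q) q) (entry w q)
    rw [LinearMap.comp_apply, LinearMap.zero_apply] at h3
    rw [Nat.add_sub_add_right] at h1
    rw [entry_totD_succ, entry_totD_succ, entry_totD_succ, map_add, map_add,
      Nat.add_sub_add_right, Nat.add_sub_add_right, h2, h3, add_zero, zero_add]
    exact h1

variable {φ : H →ₗ[k] R} (hφ : P.IsNormalLeftHaar φ)
include hφ

/-- Induction on a bound m for the nonzero rows. The top entry is a vertical cocycle because nothing
lies above it, so it lifts to a y one row lower in its column; subtracting the total differential of
y clears the top row and changes only the row below. -/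
theorem exists_eq_totD_add_edge_aux (n m : ℕ) (w : P.Tot (n + 1))
    (hw : ∀ q, entry (P.totD (n + 1) w) (q + 1) = 0) (hm : ∀ q, m < q → entry w q = 0) :
    ∃ u r, w = P.totD n u + P.edge (n + 1) r := by
  induction m generalizing w with
  | zero =>
    refine ⟨0, entry w 0, tot_ext fun q => ?_⟩
    rw [map_zero, zero_add]
    cases q with
    | zero => exact (entry_edge_zero _ _).symm
    | succ q =>
      rw [hm _ q.succ_pos]
      exact (entry_edge_succ _ _ _).symm
  | succ m ih =>
    by_cases hmn : m < n + 1
    · have h1 := hw (m + 1)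
      rw [entry_totD_succ, hm (m + 1 + 1) (by omega), map_zero, add_zero,
        Nat.add_sub_add_right] at h1
      obtain ⟨y, hy⟩ := exists_vert_eq hφ _ _ _ h1
      let u₀ : P.Tot n := Pi.single (⟨m, hmn⟩ : Fin (n + 1)) y
      have h2 : ∀ q, entry (P.totD (n + 1) (w - P.totD n u₀)) (q + 1) = 0 := by
        intro q
        have h3 := LinearMap.congr_fun (totD_totD hP n) u₀
        rw [LinearMap.comp_apply, LinearMap.zero_apply] at h3
        rw [map_sub, h3, sub_zero, hw]
      have h3 : ∀ q, m < q → entry (w - P.totD n u₀) q = 0 := by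
        intro q hq
        obtain ⟨j, rfl⟩ : ∃ j, q = j + 1 := ⟨q - 1, by omega⟩
        rw [entry_sub, entry_totD_succ, entry_single_of_ne hmn y (q' := j + 1) (by omega),
          map_zero, add_zero]
        by_cases hj : j = m
        · subst hj
          rw [entry_single_self, hy, sub_self]
        · rw [entry_single_of_ne hmn y hj, map_zero, sub_zero, hm _ (by omega)]
      obtain ⟨u, r, hu⟩ := ih _ h2 h3
      exact ⟨u₀ + u, r, by rw [map_add, add_assoc, ← hu, add_sub_cancel]⟩
    -- Row m + 1 lies outside the complex here, so the bound m already holds.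
    · refine ih w hw fun q hq => ?_
      rcases Nat.lt_or_eq_of_le hq with h | h
      · exact hm q h
      · exact entry_of_gt _ (by omega)

/-- A cochain whose total differential is concentrated in row zero is, up to a coboundary,
concentrated in row zero. -/
theorem exists_eq_totD_add_edge (n : ℕ) (w : P.Tot (n + 1))
    (hw : ∀ q, entry (P.totD (n + 1) w) (q + 1) = 0) :
    ∃ u r, w = P.totD n u + P.edge (n + 1) r :=
  exists_eq_totD_add_edge_aux hP hφ n (n + 1) w hw fun _ hq => entry_of_gt _ hq

/-- The remaining r sits in an odd column, where -β is injective, and the row 1 entry of the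
differential forces r = 0. Nothing is assumed about row 0 of the differential, so that the lemma
also applies to a w whose differential is an edge element. -/
theorem exists_eq_totD_of_odd (i : ℕ) (w : P.Tot (2 * i + 1))
    (hw : ∀ q, entry (P.totD (2 * i + 1) w) (q + 1) = 0) : ∃ u, w = P.totD (2 * i) u := by
  obtain ⟨u, r, rfl⟩ := exists_eq_totD_add_edge hP hφ (2 * i) w hw
  have h1 := LinearMap.congr_fun (totD_totD hP (2 * i)) u
  rw [LinearMap.comp_apply, LinearMap.zero_apply] at h1
  have h2 := hw 0
  have h4 : P.totD (2 * i + 1) (P.totD (2 * i) u + P.edge (2 * i + 1) r) =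
      P.totD (2 * i + 1) (P.edge (2 * i + 1) r) := by rw [map_add, h1, zero_add]
  rw [h4, entry_totD_succ, entry_edge_zero, entry_edge_succ, map_zero,
    add_zero] at h2
  have h3 : r = 0 := eq_zero_of_vert_zero hφ (by simp) r h2
  exact ⟨u, by rw [h3, map_zero, add_zero]⟩

theorem subsingleton_HC_odd (i : ℕ) : Subsingleton (P.HC (2 * i + 1)) := by
  refine Submodule.Quotient.subsingleton_iff.2 (eq_top_iff.2 fun w _ => ?_)
  have hw : P.totD _ w.1 = 0 := w.2
  obtain ⟨u, hu⟩ := exists_eq_totD_of_odd hP hφ i w.1 fun q => by rw [hw, entry_zero]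
  exact ⟨u, hu.symm⟩

omit hP in
-- Horizontally 1 - λ is 0 in row 0. Vertically b = β - α is 0, because a normal Haar system forces
-- α = β.
theorem edge_mem_cocycles (i : ℕ) (r : R) : P.edge (2 * i) r ∈ P.cocycles (2 * i) := by
  have hi : Even (2 * i) := even_two_mul i
  refine LinearMap.mem_ker.2 (tot_ext fun q => ?_)
  rw [entry_zero]
  match q with
  | 0 =>
    rw [entry_totD_zero, horiz, if_pos hi, lam, pow_zero, one_smul]
    exact sub_self _
  | 1 =>
    -- Since φ β = id, this is α φ = β φ evaluated at β(r).
    have h1 : P.tgt (MulOpposite.op r) = P.src r := by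
      have h2 : φ (P.tgt (MulOpposite.op r)) = r := by
        have h2 := hφ.right_module 1 r
        rwa [mul_one, hφ.normal, one_mul] at h2
      have h3 := hφ.src_eq_tgt (P.tgt (MulOpposite.op r))
      rw [h2] at h3
      exact h3.symm
    rw [entry_totD_succ, entry_edge_zero, entry_edge_succ, map_zero, add_zero, vert, Nat.sub_zero,
      if_pos hi]
    have h4 : P.hoch 0 = P.coface 0 0 - P.coface 0 1 := by
      simp [hoch, Finset.sum_range_succ, sub_eq_add_neg]
    rw [h4]
    exact sub_eq_zero.2 h1
  | q + 2 =>
    rw [entry_totD_succ, entry_edge_succ, entry_edge_succ, map_zero, map_zero, add_zero]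

/-- The map from `R` to the even cyclic cohomology. -/
def edgeClass (i : ℕ) : R →ₗ[k] P.HC (2 * i) :=
  Submodule.mkQ _ ∘ₗ (P.edge (2 * i)).codRestrict (P.cocycles (2 * i)) (edge_mem_cocycles hφ i)

omit hP hφ in
theorem edge_injective (n : ℕ) : Function.Injective (P.edge n) := fun r s h => by
  rw [← entry_edge_zero (P := P) n r, h, entry_edge_zero]

theorem edgeClass_bijective (i : ℕ) : Function.Bijective (edgeClass hφ i) := by
  constructor
  · refine (injective_iff_map_eq_zero _).2 fun r hr => ?_
    have hr' : Submodule.Quotient.mk (p := (P.coboundaries (2 * i)).comap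
        (P.cocycles (2 * i)).subtype) ⟨P.edge (2 * i) r, edge_mem_cocycles hφ i r⟩ = 0 := hr
    have h0 := (Submodule.Quotient.mk_eq_zero _).1 hr'
    have h1 : P.edge (2 * i) r ∈ P.coboundaries (2 * i) := h0
    refine edge_injective _ (Eq.trans ?_ (map_zero (P.edge (2 * i))).symm)
    match i with
    | 0 => exact (Submodule.mem_bot _).1 h1
    | i + 1 =>
      obtain ⟨w, hw⟩ := h1
      -- A primitive w of an edge element has odd degree and is itself a coboundary, so the edge
      -- element is D² u = 0.
      obtain ⟨u, rfl⟩ := exists_eq_totD_of_odd hP hφ i w fun q =>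
        (congrArg (entry · (q + 1)) hw).trans (entry_edge_succ _ q r)
      rw [← hw]
      exact LinearMap.congr_fun (totD_totD hP (2 * i)) u
  · intro x
    obtain ⟨⟨w, hw⟩, rfl⟩ := Submodule.mkQ_surjective _ x
    match i with
    | 0 =>
      refine ⟨entry w 0, congrArg (Submodule.mkQ _) (Subtype.ext (tot_ext fun q => ?_))⟩
      cases q with
      | zero => exact entry_edge_zero _ _
      | succ q =>
        rw [entry_of_gt w (show 2 * 0 < q + 1 by omega)]
        exact entry_edge_succ _ _ _
    | i + 1 =>
      have hw' : P.totD _ w = 0 := hw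
      obtain ⟨u, r, hu⟩ := exists_eq_totD_add_edge hP hφ (2 * i + 1) w fun q => by
        exact (congrArg (entry · (q + 1)) hw').trans (entry_zero _)
      refine ⟨r, (Submodule.Quotient.eq _).2 ⟨-u, ?_⟩⟩
      rw [map_neg]
      change _ = P.edge _ r - w
      rw [hu]
      exact (sub_add_cancel_right _ _).symm

end

end ParaHopfAlgebroid

/-! ### The cocyclic identities for the torus in homogeneous coordinates -/

namespace NCTorus

open LaurentPolynomial (T)

variable (θ : ℝ)

/-- The element `U^a V^{m 0} ⊗ V^{m 1} ⊗ ⋯ ⊗ V^{m n}`. -/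
def powMono : (n : ℕ) → ℤ → (ℕ → ℤ) → ((bialgebroid θ).pow n).carrier
  | 0, a, m => mono θ a (m 0)
  | n + 1, a, m => (bialgebroid θ).tmk ((bialgebroid θ).pow n).ract
      (mono θ a (m 0) ⊗ₜ[ℂ] powMono n 0 fun i => m (i + 1))

theorem powMono_succ (n : ℕ) (a : ℤ) (m : ℕ → ℤ) :
    powMono θ (n + 1) a m = (bialgebroid θ).tmk ((bialgebroid θ).pow n).ract
      (mono θ a (m 0) ⊗ₜ[ℂ] powMono θ n 0 fun i => m (i + 1)) := rfl

theorem powMono_congr (n : ℕ) (a : ℤ) {m m' : ℕ → ℤ} (h : ∀ i ≤ n, m i = m' i) :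
    powMono θ n a m = powMono θ n a m' := by
  induction n generalizing a m m' with
  | zero => rw [powMono, powMono, h 0 le_rfl]
  | succ n ih =>
    rw [powMono, powMono, h 0 (Nat.zero_le _), ih 0 fun i hi => h (i + 1) (Nat.succ_le_succ hi)]

theorem ract_powMono (n : ℕ) (b a : ℤ) (m : ℕ → ℤ) :
    ((bialgebroid θ).pow n).ract (T b) (powMono θ n a m) = powMono θ n (b + a) m := by
  cases n with
  | zero =>
    change embed θ (T b) * mono θ a (m 0) = _
    rw [embed_T, mono_zero_mul, powMono]
  | succ n =>
    refine ((bialgebroid θ).actTens_mk _ _ _ _).trans ?_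
    change (bialgebroid θ).tmk _ ((embed θ (T b) * mono θ a (m 0)) ⊗ₜ[ℂ] _) = _
    rw [embed_T, mono_zero_mul, powMono]

theorem hact_powMono (n : ℕ) (b c a : ℤ) (m : ℕ → ℤ) :
    ((bialgebroid θ).pow n).hact (mono θ b c) (powMono θ n a m) =
      torusQ θ ^ (-(c * a)) • powMono θ n (b + a) fun i => c + m i := by
  induction n generalizing b a m with
  | zero => exact mono_mul θ b c a (m 0)
  | succ n ih =>
    refine (tensor_hact_mono θ ((bialgebroid θ).pow n) b c a (m 0) _).trans ?_
    rw [ih, mul_zero, neg_zero, zpow_zero, one_smul, add_zero, powMono]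
    rfl

theorem tmk_mono_powMono (n : ℕ) (a b c : ℤ) (m : ℕ → ℤ) :
    (bialgebroid θ).tmk ((bialgebroid θ).pow n).ract (mono θ a c ⊗ₜ[ℂ] powMono θ n b m) =
      (bialgebroid θ).tmk ((bialgebroid θ).pow n).ract
        (mono θ (b + a) c ⊗ₜ[ℂ] powMono θ n 0 m) := by
  have h1 := ract_powMono θ n b 0 m
  rw [add_zero] at h1
  rw [← h1]
  exact tmk_mono_act θ ((bialgebroid θ).pow n).ract a c b (powMono θ n 0 m)

/-- Applying Δ repeats an exponent, and the appended 1 is V^0; both are substitutions of indices,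
apart from the value 0 in the last place. -/
theorem cofaceSucc_powMono (n i : ℕ) (hi : i ≤ n + 1) (a : ℤ) (m : ℕ → ℤ) :
    ((bialgebroid θ).cofaceSucc n i).1 (powMono θ n a m) =
      powMono θ (n + 1) a fun j => if j = n + 1 ∧ i = n + 1 then 0 else
        m (if j ≤ i then j else j - 1) := by
  induction n generalizing i a m with
  | zero =>
    match i with
    | 0 =>
      refine (torusComul_mono θ a (m 0)).trans ?_
      simp [powMono]
      rfl
    | 1 =>
      change (bialgebroid θ).mkHH (mono θ a (m 0) ⊗ₜ[ℂ] 1) = _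
      rw [← mono_zero_zero]
      simp [powMono]
      rfl
  | succ n ih =>
    match i with
    | 0 =>
      refine ((bialgebroid θ).comulTens_mk _ _ _).trans ?_
      have h1 : (bialgebroid θ).comul (mono θ a (m 0)) =
        (bialgebroid θ).mkHH (mono θ a (m 0) ⊗ₜ[ℂ] mono θ 0 (m 0)) := torusComul_mono θ a (m 0)
      rw [h1, BialgebroidBase.assoc_tmul, powMono, powMono]
      simp
      rfl
    | i + 1 =>
      refine ((bialgebroid θ).idTens_mk _ _ _ ((bialgebroid θ).cofaceSucc n i).2 _ _).trans ?_
      rw [ih i (by omega), powMono_succ θ (n + 1) a]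
      have h1 : (if 0 = n + 1 + 1 ∧ i + 1 = n + 1 + 1 then 0 else
          m (if 0 ≤ i + 1 then 0 else 0 - 1)) = m 0 := by simp
      rw [h1]
      refine congrArg (fun y => (bialgebroid θ).tmk _ (mono θ a (m 0) ⊗ₜ[ℂ] y))
        (powMono_congr θ (n + 1) 0 fun j _ => ?_)
      simp only [Nat.add_right_cancel_iff, Nat.add_le_add_iff_right]
      split_ifs
      · rfl
      · rfl
      · congr 1
        omega

/-- Only spanning is needed: powers of U in later factors move to the first. Independence of these
tensors is never used. -/
theorem powMono_hom_ext {Q : Type*} [AddCommGroup Q] [Module ℂ Q] (n : ℕ)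
    {f g : ((bialgebroid θ).pow n).carrier →ₗ[ℂ] Q}
    (h : ∀ a m, f (powMono θ n a m) = g (powMono θ n a m)) : f = g := by
  induction n generalizing Q with
  | zero => exact mono_hom_ext fun a c => h a fun _ => c
  | succ n ih =>
    have h1 : (TensorProduct.mk ℂ _ _).compr₂ (f ∘ₗ (bialgebroid θ).tmk _) =
        (TensorProduct.mk ℂ (NCTorus θ) ((bialgebroid θ).pow n).carrier).compr₂
          (g ∘ₗ (bialgebroid θ).tmk _) := by
      refine mono_hom_ext fun a c => ih fun b m => ?_
      have h2 := h (b + a) fun i => if i = 0 then c else m (i - 1)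
      have h3 : powMono θ (n + 1) (b + a) (fun i => if i = 0 then c else m (i - 1)) =
        (bialgebroid θ).tmk _ (mono θ a c ⊗ₜ[ℂ] powMono θ n b m) := by
        rw [tmk_mono_powMono]; rfl
      rw [h3] at h2
      exact h2
    refine (bialgebroid θ).tens_ext fun a x => ?_
    exact LinearMap.congr_fun (LinearMap.congr_fun h1 a) x

/-- The cochain `U^a` in degree zero and `U^a V^{m 0} ⊗ V^{m 1} ⊗ ⋯ ⊗ V^{m (n - 1)}` in degree
`n`. -/
def monoCochain : (n : ℕ) → ℤ → (ℕ → ℤ) → (paraHopf θ).Cochain n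
  | 0, a, _ => (T a : ℂ[T;T⁻¹])
  | n + 1, a, m => powMono θ n a m

theorem monoCochain_succ (n : ℕ) (a : ℤ) (m : ℕ → ℤ) :
    monoCochain θ (n + 1) a m = powMono θ n a m := rfl

theorem monoCochain_congr (n : ℕ) (a : ℤ) {m m' : ℕ → ℤ} (h : ∀ i < n, m i = m' i) :
    monoCochain θ n a m = monoCochain θ n a m' := by
  cases n with
  | zero => rfl
  | succ n => exact powMono_congr θ n a fun i hi => h i (Nat.lt_succ_of_le hi)

/-- The cochain that corresponds to the homogeneous coordinates `x 0, …, x n`. -/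
def cochain (n : ℕ) (a : ℤ) (x : ℕ → ℤ) : (paraHopf θ).Cochain n :=
  torusQ θ ^ (a * x 0) • monoCochain θ n a fun i => x (i + 1) - x 0

theorem cochain_congr (n : ℕ) (a : ℤ) {x y : ℕ → ℤ} (h : ∀ i ≤ n, x i = y i) :
    cochain θ n a x = cochain θ n a y := by
  rw [cochain, cochain, h 0 (Nat.zero_le _), monoCochain_congr θ n a fun i hi => by
    rw [h (i + 1) hi]]

/-- The choice x_0 = 0 recovers every monomial cochain. The family is redundant, as translating x
only rescales by a power of q, but a spanning set is enough. -/
theorem cochain_hom_ext {Q : Type*} [AddCommGroup Q] [Module ℂ Q] (n : ℕ)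
    {f g : (paraHopf θ).Cochain n →ₗ[ℂ] Q}
    (h : ∀ a x, f (cochain θ n a x) = g (cochain θ n a x)) : f = g := by
  have h1 : ∀ a m, f (monoCochain θ n a m) = g (monoCochain θ n a m) := by
    intro a m
    have h2 : cochain θ n a (fun i => if i = 0 then 0 else m (i - 1)) = monoCochain θ n a m := by
      simp [cochain]
    rw [← h2]
    exact h _ _
  cases n with
  | zero => exact laurent_hom_ext fun a => h1 a 0
  | succ n => exact powMono_hom_ext θ n h1

/-- The map of indices that induces the coface `δ_i` in homogeneous coordinates. -/
def dup (n i j : ℕ) : ℕ := if j = n + 1 ∧ i = n + 1 then 0 else if j ≤ i then j else j - 1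

/-- The map of indices that induces the cyclic operator in homogeneous coordinates. -/
def rot (n j : ℕ) : ℕ := if j = n then 0 else j + 1

theorem coface_monoCochain (n i : ℕ) (hi : i ≤ n + 1) (a : ℤ) (x : ℕ → ℤ) :
    (paraHopf θ).coface n i (monoCochain θ n a fun j => x (j + 1) - x 0) =
      monoCochain θ (n + 1) a fun j => x (dup n i (j + 1)) - x 0 := by
  match n, i with
  | 0, i =>
    have h1 : x (dup 0 i 1) - x 0 = 0 := by
      have h : dup 0 i 1 = 0 := by
        obtain rfl | rfl : i = 0 ∨ i = 1 := by omega
        · rfl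
        · rfl
      rw [h, sub_self]
    have h2 : monoCochain θ (0 + 1) a (fun j => x (dup 0 i (j + 1)) - x 0) = mono θ a 0 :=
      congrArg (mono θ a) h1
    rw [h2]
    match i with
    | 0 => exact embed_T θ a
    | i + 1 => exact embed_T θ a
  | n + 1, 0 =>
    have h1 := tmk_mono_powMono θ n 0 a 0 fun j => x (j + 1) - x 0
    rw [mono_zero_zero] at h1
    refine h1.trans ?_
    rw [monoCochain_succ, powMono_succ]
    simp [dup]
  | n + 1, i + 1 =>
    refine (cofaceSucc_powMono θ n i (by omega) a _).trans ?_
    rw [monoCochain_succ]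
    refine powMono_congr θ (n + 1) a fun j _ => ?_
    simp only [dup, Nat.add_right_cancel_iff, Nat.add_le_add_iff_right]
    split_ifs
    · simp
    · rfl
    · rw [show j - 1 + 1 = j + 1 - 1 by omega]

theorem coface_cochain (n i : ℕ) (hi : i ≤ n + 1) (a : ℤ) (x : ℕ → ℤ) :
    (paraHopf θ).coface n i (cochain θ n a x) = cochain θ (n + 1) a fun j => x (dup n i j) := by
  have h0 : dup n i 0 = 0 := by simp [dup]
  rw [cochain, cochain, h0, map_smul, coface_monoCochain θ n i hi]

/-- The para-antipode turns the first factor into a multiple of U^a V^(x_0 - x_1). Its diagonal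
action recentres all exponents from x_0 to x_1, and the appended 1 becomes V^(x_0 - x_1). -/
theorem cyc_monoCochain (n : ℕ) (a : ℤ) (x : ℕ → ℤ) :
    (paraHopf θ).cyc n (monoCochain θ n a fun j => x (j + 1) - x 0) =
      torusQ θ ^ (a * (x (rot n 0) - x 0)) •
        monoCochain θ n a fun j => x (rot n (j + 1)) - x (rot n 0) := by
  match n with
  | 0 => simp [rot]; rfl
  | 1 =>
    refine (torusAnti_mono θ a (x 1 - x 0)).trans ?_
    rw [neg_sub]
    rfl
  | n + 2 =>
    have h1 : ((bialgebroid θ).pow (n + 1)).hact (torusAnti θ (mono θ a (x 1 - x 0)))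
          (((bialgebroid θ).cofaceSucc n (n + 1)).1
            (powMono θ n 0 fun i => x (i + 1 + 1) - x 0)) =
        torusQ θ ^ (a * (x 1 - x 0)) • powMono θ (n + 1) a fun j =>
          x (rot (n + 2) (j + 1)) - x 1 := by
      rw [cofaceSucc_powMono θ n _ le_rfl, torusAnti_mono, map_smul, LinearMap.smul_apply,
        hact_powMono, mul_zero, neg_zero, zpow_zero, one_smul, add_zero]
      congr 1
      refine powMono_congr θ (n + 1) a fun j hj => ?_
      by_cases h : j = n + 1
      · simp [rot, h]
      · simp [rot, h, hj]
    refine Eq.trans ?_ h1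
    rfl

theorem cyc_cochain (n : ℕ) (a : ℤ) (x : ℕ → ℤ) :
    (paraHopf θ).cyc n (cochain θ n a x) = cochain θ n a fun j => x (rot n j) := by
  rw [cochain, cochain, map_smul, cyc_monoCochain, smul_smul, ← zpow_add₀ (torusQ_ne_zero θ)]
  ring_nf

theorem rot_iterate (n j k : ℕ) (hk : k ≤ n) (hj : j ≤ n + 1) :
    (rot n)^[j] k = if k + j ≤ n then k + j else k + j - (n + 1) := by
  induction j with
  | zero => simp [hk]
  | succ j ih =>
    rw [Function.iterate_succ_apply', ih (by omega), rot]
    split_ifs <;> omega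

theorem cyc_pow_cochain (n j : ℕ) (a : ℤ) (x : ℕ → ℤ) :
    ((paraHopf θ).cyc n ^ j) (cochain θ n a x) = cochain θ n a fun i => x ((rot n)^[j] i) := by
  induction j with
  | zero => rfl
  | succ j ih =>
    rw [pow_succ', Module.End.mul_apply, ih, cyc_cochain]
    rfl

/-- On the spanning cochains each identity compares two composites of `dup` and `rot` on the
finitely many indices that matter, a question of linear arithmetic. -/
theorem isCocyclic : (paraHopf θ).IsCocyclic where
  coface_coface n i j hij hj := by
    refine cochain_hom_ext θ n fun a x => ?_
    rw [LinearMap.comp_apply, LinearMap.comp_apply, coface_cochain θ n i (by omega),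
      coface_cochain θ n j hj, coface_cochain θ _ _ (by omega), coface_cochain θ _ _ (by omega)]
    refine cochain_congr θ _ a fun l hl => congrArg x ?_
    simp only [dup]
    split_ifs <;> omega
  cyc_coface_zero n := by
    refine cochain_hom_ext θ n fun a x => ?_
    rw [LinearMap.comp_apply, coface_cochain θ n 0 (by omega), coface_cochain θ n _ le_rfl,
      cyc_cochain]
    refine cochain_congr θ _ a fun l hl => congrArg x ?_
    by_cases h : l = n + 1
    · simp [dup, rot, h]
    · simp [dup, rot, h]
      omega
  cyc_coface_succ n i hi := by
    refine cochain_hom_ext θ n fun a x => ?_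
    rw [LinearMap.comp_apply, LinearMap.comp_apply, cyc_cochain, coface_cochain θ n _ (by omega),
      coface_cochain θ n _ (by omega), cyc_cochain]
    refine cochain_congr θ _ a fun l hl => congrArg x ?_
    simp only [dup, rot]
    split_ifs <;> omega
  cyc_pow n := by
    refine cochain_hom_ext θ n fun a x => ?_
    rw [cyc_pow_cochain, Module.End.one_apply]
    refine cochain_congr θ _ a fun l hl => congrArg x ?_
    rw [rot_iterate n _ l hl le_rfl]
    split_ifs <;> omega

end NCTorus

end ParaHopf

end

/-! ### The corollary -/

theorem mainTheorem6 (θ : ℝ) :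
    ∃ P : ParaHopf.ParaHopfAlgebroid ℂ (ParaHopf.NCTorus θ) ℂ[T;T⁻¹],
      -- source and target are the natural embedding of `ℂ[U, U⁻¹]`
      (∀ n : ℤ, P.src (LaurentPolynomial.T n) = ParaHopf.NCTorus.mono θ n 0) ∧
      Function.Injective P.src ∧
      (∀ r : ℂ[T;T⁻¹], P.tgt (MulOpposite.op r) = P.src r) ∧
      -- coproduct, counit and para-antipode
      (∀ n m : ℤ, P.comul (ParaHopf.NCTorus.mono θ n m) =
        P.mkHH (ParaHopf.NCTorus.mono θ n m ⊗ₜ[ℂ] ParaHopf.NCTorus.mono θ 0 m)) ∧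
      (∀ n m : ℤ, P.counit (ParaHopf.NCTorus.mono θ n m) = LaurentPolynomial.T n) ∧
      (∀ n m : ℤ, P.anti (ParaHopf.NCTorus.mono θ n m) =
        ParaHopf.torusQ θ ^ (n * m) • ParaHopf.NCTorus.mono θ n (-m)) ∧
      -- the normal left Haar system
      (∃ φ : ParaHopf.NCTorus θ →ₗ[ℂ] ℂ[T;T⁻¹], P.IsNormalLeftHaar φ ∧
        ∀ n m : ℤ, φ (ParaHopf.NCTorus.mono θ n m) =
          if m = 0 then LaurentPolynomial.T n else 0) ∧
      -- the cyclic bicomplex has a total complex, and its cohomology is as claimed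
      (∀ n : ℕ, P.totD (n + 1) ∘ₗ P.totD n = 0) ∧
      (∀ i : ℕ, Subsingleton (P.HC (2 * i + 1))) ∧
      (∀ i : ℕ, ∃ e : ℂ[T;T⁻¹] ≃ₗ[ℂ] P.HC (2 * i), ∀ r : ℂ[T;T⁻¹],
        ∃ h : P.edge (2 * i) r ∈ P.cocycles (2 * i),
          e r = Submodule.Quotient.mk ⟨P.edge (2 * i) r, h⟩) := by
  open ParaHopf ParaHopf.NCTorus in
  refine ⟨paraHopf θ, embed_T θ, fun r s h => ?_, fun _ => rfl, torusComul_mono θ,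
    torusCounit_mono θ, torusAnti_mono θ, ⟨torusHaar θ, isNormalLeftHaar θ, torusHaar_mono θ⟩,
    ParaHopfAlgebroid.totD_totD (isCocyclic θ),
    ParaHopfAlgebroid.subsingleton_HC_odd (isCocyclic θ) (isNormalLeftHaar θ), fun i => ?_⟩
  -- The counit is a left inverse of the embedding, which is therefore injective.
  · exact (torusCounit_embed θ r).symm.trans ((congrArg _ h).trans (torusCounit_embed θ s))
  · exact ⟨LinearEquiv.ofBijective _
      (ParaHopfAlgebroid.edgeClass_bijective (isCocyclic θ) (isNormalLeftHaar θ) i),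
      fun r => ⟨ParaHopfAlgebroid.edge_mem_cocycles (isNormalLeftHaar θ) i r, rfl⟩⟩
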